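/- Let $\mathbb{D}=\{z\in\mathbb{C}:|z|<1\}$ and let $dA=\frac{dx\,dy}{\pi}$ be the normalized area measure on $\mathbb{D}$. A radial weight is a nonnegative function $\omega\in L^1([0,1))$, extended to $\mathbb{D}$ by $\omega(z)=\omega(|z|)$, such that $\widehat{\omega}(r)=\int_r^1\omega(s)\,ds>0$ for all $0\le r<1$. It belongs to the class $\widehat{\mathcal{D}}$ if there is a constant $C=C(\omega)>0$ such that $\widehat{\omega}(r)\le C\,\widehat{\omega}\left(\frac{1+r}{2}\right)$ for all $0\le r<1$. For $a\in\mathbb{D}$, let $B^\omega_a$ denote the reproducing kernel at $a$ of the weighted Bergman space $A^2_\omega$ of holomorphic functions $f$ in $\mathbb{D}$ with $\int_{\mathbb{D}}|f|^2\,\omega\,dA<\infty$; that is, $B^\omega_a\in A^2_\omega$ and $f(a)=\int_{\mathbb{D}}f(\zeta)\overline{B^\omega_a(\zeta)}\,\omega(\zeta)\,dA(\zeta)$ for all $f\in A^2_\omega$. For a radial weight $\mu$ with moments $\mu_{x}=\int_0^1 s^{x}\mu(s)\,ds$, the fractional derivative of a holomorphic function $f(z)=\sum_{n=0}^\infty\widehat{f}(n)z^n$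 in $\mathbb{D}$ is $D^\mu(f)(z)=\sum_{n=0}^\infty\frac{\widehat{f}(n)}{\mu_{2n+1}}z^n$, $z\in\mathbb{D}$. Finally, let $M_1(r,f)=\frac{1}{2\pi}\int_0^{2\pi}|f(re^{i\theta})|\,d\theta$ for $0\le r<1$. Proposition 2.4. Let $\omega,\mu\in\widehat{\mathcal{D}}$. Then there exist constants $c,C>0$, depending only on $\omega$ and $\mu$, such that for all $a\in\mathbb{D}$ and all $r\in[0,1)$, $$c\left(1+\int_0^{r|a|}\frac{dt}{\widehat{\omega}(t)\,\widehat{\mu}(t)\,(1-t)}\right)\le M_1\left(r,D^\mu(B^\omega_a)\right)\le C\left(1+\int_0^{r|a|}\frac{dt}{\widehat{\omega}(t)\,\widehat{\mu}(t)\,(1-t)}\right).$$ -/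

import Mathlib

open MeasureTheory Set
open scoped Real ComplexConjugate

noncomputable section

namespace BergmanDisc

/-- The tail integral `ω̂(r) = ∫_r^1 ω(s) ds`. -/
def tail (ω : ℝ → ℝ) (r : ℝ) : ℝ := ∫ s in r..1, ω s

/-- The moment `ω_x = ∫_0^1 s^x ω(s) ds`, for natural exponents `x`. -/
def moment (ω : ℝ → ℝ) (n : ℕ) : ℝ := ∫ s in (0 : ℝ)..1, s ^ n * ω s

/-- `ω` is (the profile of) a radial weight: a nonnegative function in `L¹([0,1))` with
`ω̂ > 0` on `[0,1)`. Its extension to the unit disc is `z ↦ ω ‖z‖`. Only the values of `ω` on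
`[0,1)` matter. -/
structure IsRadialWeight (ω : ℝ → ℝ) : Prop where
  nonneg : ∀ r ∈ Ico (0 : ℝ) 1, 0 ≤ ω r
  integrableOn : IntegrableOn ω (Ico 0 1)
  tail_pos : ∀ r ∈ Ico (0 : ℝ) 1, 0 < tail ω r

/-- The class `𝒟̂` of radial weights with the upper doubling property
`ω̂(r) ≤ C ω̂((1+r)/2)` for `0 ≤ r < 1`. -/
structure IsUpperDoubling (ω : ℝ → ℝ) : Prop extends IsRadialWeight ω where
  doubling : ∃ C : ℝ, 0 < C ∧ ∀ r ∈ Ico (0 : ℝ) 1, tail ω r ≤ C * tail ω ((1 + r) / 2)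

/-- The normalized area measure `dA = dx dy / π` on the unit disc. -/
def discArea : Measure ℂ := ENNReal.ofReal π⁻¹ • volume.restrict (Metric.ball 0 1)

/-- Membership in the weighted Bergman space `A²_ω`: `f` is holomorphic in the unit disc and
`∫ |f|² ω dA < ∞`. -/
structure MemBergmanTwo (ω : ℝ → ℝ) (f : ℂ → ℂ) : Prop where
  differentiableOn : DifferentiableOn ℂ f (Metric.ball 0 1)
  integrable : Integrable (fun z => ‖f z‖ ^ 2 * ω ‖z‖) discArea

/-- `B` is the reproducing kernel of `A²_ω` at the point `a`: `B ∈ A²_ω` and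
`f(a) = ∫ f(ζ) conj(B(ζ)) ω(ζ) dA(ζ)` for every `f ∈ A²_ω`. -/
structure IsReproducingKernelAt (ω : ℝ → ℝ) (a : ℂ) (B : ℂ → ℂ) : Prop where
  mem : MemBergmanTwo ω B
  reproducing : ∀ f : ℂ → ℂ, MemBergmanTwo ω f →
    f a = ∫ ζ, f ζ * conj (B ζ) * (ω ‖ζ‖ : ℂ) ∂discArea

open Classical in
/-- The Bergman reproducing kernel `B^ω_a` of `A²_ω` at `a`. For a radial weight `ω` and `|a| < 1`
it exists and is unique on the unit disc. -/
def bergmanKernel (ω : ℝ → ℝ) (a : ℂ) : ℂ → ℂ :=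
  if h : ∃ B : ℂ → ℂ, IsReproducingKernelAt ω a B then h.choose else 0

/-- The `n`-th Taylor coefficient of `f` at the origin. -/
def taylorCoeff (f : ℂ → ℂ) (n : ℕ) : ℂ := iteratedDeriv n f 0 / (n.factorial : ℂ)

/-- The fractional derivative `D^μ(f)(z) = ∑ f̂(n) / μ_{2n+1} z^n` induced by `μ`. -/
def fracDeriv (μ : ℝ → ℝ) (f : ℂ → ℂ) (z : ℂ) : ℂ :=
  ∑' n : ℕ, taylorCoeff f n / (moment μ (2 * n + 1) : ℂ) * z ^ n

/-- The integral mean `M_p(r, f) = ((1/2π) ∫_0^{2π} |f(r e^{iθ})|^p dθ)^{1/p}`. -/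
def integralMean (p r : ℝ) (f : ℂ → ℂ) : ℝ :=
  ((2 * π)⁻¹ * ∫ θ in (0 : ℝ)..2 * π, ‖f (r * Complex.exp (θ * Complex.I))‖ ^ p) ^ (1 / p)

end BergmanDisc

end

noncomputable section

namespace BergmanDisc

/-! ### Tails and moments of radial weights -/

/-! Testing the reproducing property on monomials shows that `B^ω_a` has Taylor coefficients `conj a
^ n / (2 ω_{2n+1})`. Hence `D^μ(B^ω_a)(z) = G(conj a * z)` with `G(w) = ∑ g n * w ^ n` and `g n = 1
/ (2 ω_{2n+1} μ_{2n+1})`, and by rotation invariance only the `L¹` mean of `G` on the circle of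
radius `ρ = r‖a‖` matters (`integralMean_fracDeriv_bergmanKernel`). Doubling makes `ω_n` comparable
to `ω̂(1 - 1/n)`, so `g n` behaves like `h(1 - 1/n)` with `h = 1 / (ω̂ μ̂)`, and the mean is to be
compared with `1 + ∫_0^ρ h(t)/(1-t) dt`.

Lower bound (`le_seriesMean`): Hardy's inequality bounds the mean below by a multiple of `g 0 + ∑ g
(n+1) ρ^(n+1) / (n+1)`. The last sum is `∫_0^ρ ∑ g (n+1) t^n dt`, and the terms with `n` beyond
about `1/(1-t)` already make the integrand at least a multiple of `h(t)/(1-t)`.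

Upper bound (`exists_seriesMean_le`): integrating `G'` along radii, it suffices that its `L¹` norm
on the circle of radius `t` is `O(h(t)/(1-t))`. Split `G' = (1-z)⁻¹ · (1-z)G'` and apply
Cauchy-Schwarz and Parseval. The coefficients of `(1-z)G'` are the increments of `n g n`, which are
`O(g (n+1))` because `n (ω_{2n+1} - ω_{2n+3}) = O(ω_{2n+1})`. Moreover `g (n+1) ≤ C (1 + n(1-t))^K
h(t)`, a polynomial loss that the powers of `t` absorb. -/

lemma IsRadialWeight.intervalIntegrable {ω : ℝ → ℝ} (h : IsRadialWeight ω) {a b : ℝ}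
    (ha : 0 ≤ a) (hab : a ≤ b) (hb : b ≤ 1) : IntervalIntegrable ω volume a b := by
  have h01 : IntervalIntegrable ω volume 0 1 :=
    (intervalIntegrable_iff_integrableOn_Ico_of_le zero_le_one).2 h.integrableOn
  refine h01.mono_set ?_
  rw [uIcc_of_le hab, uIcc_of_le zero_le_one]
  exact Icc_subset_Icc ha hb

lemma IsRadialWeight.intervalIntegrable_pow_mul {ω : ℝ → ℝ} (h : IsRadialWeight ω) (n : ℕ)
    {a b : ℝ} (ha : 0 ≤ a) (hab : a ≤ b) (hb : b ≤ 1) :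
    IntervalIntegrable (fun s => s ^ n * ω s) volume a b :=
  (h.intervalIntegrable ha hab hb).continuousOn_mul (continuousOn_pow n)

lemma IsRadialWeight.integral_pow_mul_nonneg {ω : ℝ → ℝ} (h : IsRadialWeight ω) (n : ℕ) {a b : ℝ}
    (ha : 0 ≤ a) (hab : a ≤ b) (hb : b ≤ 1) : 0 ≤ ∫ s in a..b, s ^ n * ω s := by
  have := intervalIntegral.integral_mono_on_of_le_Ioo (f := fun _ => (0 : ℝ)) hab
    intervalIntegrable_const (h.intervalIntegrable_pow_mul n ha hab hb) (fun s hs =>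
      mul_nonneg (pow_nonneg (ha.trans hs.1.le) n)
        (h.nonneg s ⟨ha.trans hs.1.le, hs.2.trans_le hb⟩))
  simpa using this

lemma IsRadialWeight.moment_eq_add {ω : ℝ → ℝ} (h : IsRadialWeight ω) (n : ℕ) {r : ℝ}
    (hr : 0 ≤ r) (hr1 : r ≤ 1) :
    moment ω n = (∫ s in (0 : ℝ)..r, s ^ n * ω s) + ∫ s in r..1, s ^ n * ω s :=
  (intervalIntegral.integral_add_adjacent_intervals
    (h.intervalIntegrable_pow_mul n le_rfl hr hr1)
    (h.intervalIntegrable_pow_mul n hr hr1 le_rfl)).symm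

lemma IsRadialWeight.integral_pow_mul_le {ω : ℝ → ℝ} (h : IsRadialWeight ω) {m n : ℕ} {c a b : ℝ}
    (ha : 0 ≤ a) (hab : a ≤ b) (hb : b ≤ 1)
    (hc : ∀ s, a < s → s < b → s ^ n ≤ c * s ^ m) :
    ∫ s in a..b, s ^ n * ω s ≤ c * ∫ s in a..b, s ^ m * ω s := by
  rw [← intervalIntegral.integral_const_mul]
  refine intervalIntegral.integral_mono_on_of_le_Ioo hab
    (h.intervalIntegrable_pow_mul n ha hab hb)
    ((h.intervalIntegrable_pow_mul m ha hab hb).const_mul c) (fun s hs => ?_)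
  rw [← mul_assoc]
  exact mul_le_mul_of_nonneg_right (hc s hs.1 hs.2)
    (h.nonneg s ⟨ha.trans hs.1.le, hs.2.trans_le hb⟩)

lemma IsRadialWeight.tail_anti {ω : ℝ → ℝ} (h : IsRadialWeight ω) {s t : ℝ}
    (hs : 0 ≤ s) (hst : s ≤ t) (ht : t ≤ 1) : tail ω t ≤ tail ω s := by
  have h1 : tail ω s = (∫ x in s..t, ω x) + tail ω t :=
    (intervalIntegral.integral_add_adjacent_intervals
      (h.intervalIntegrable hs hst ht) (h.intervalIntegrable (hs.trans hst) ht le_rfl)).symm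
  have h2 := h.integral_pow_mul_nonneg 0 hs hst ht
  simp only [pow_zero, one_mul] at h2
  linarith

lemma IsRadialWeight.continuousOn_tail {ω : ℝ → ℝ} (h : IsRadialWeight ω) :
    ContinuousOn (tail ω) (Icc 0 1) := by
  have h1 : IntegrableOn ω (uIcc (0 : ℝ) 1) := by
    rw [uIcc_of_le zero_le_one, integrableOn_Icc_iff_integrableOn_Ico]
    exact h.integrableOn
  have h2 := intervalIntegral.continuousOn_primitive_interval_left h1
  rwa [uIcc_of_le zero_le_one] at h2

lemma IsRadialWeight.pow_mul_tail_le_moment {ω : ℝ → ℝ} (h : IsRadialWeight ω) (n : ℕ) {r : ℝ}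
    (hr : 0 ≤ r) (hr1 : r ≤ 1) : r ^ n * tail ω r ≤ moment ω n := by
  rw [h.moment_eq_add n hr hr1]
  have h1 := h.integral_pow_mul_nonneg n le_rfl hr hr1
  have h2 : r ^ n * tail ω r ≤ ∫ s in r..1, s ^ n * ω s := by
    rw [tail, ← intervalIntegral.integral_const_mul]
    refine intervalIntegral.integral_mono_on_of_le_Ioo hr1
      ((h.intervalIntegrable hr hr1 le_rfl).const_mul _)
      (h.intervalIntegrable_pow_mul n hr hr1 le_rfl) (fun s hs => ?_)
    exact mul_le_mul_of_nonneg_right (pow_le_pow_left₀ hr hs.1.le n)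
      (h.nonneg s ⟨hr.trans hs.1.le, hs.2⟩)
  linarith

lemma IsRadialWeight.moment_pos {ω : ℝ → ℝ} (h : IsRadialWeight ω) (n : ℕ) : 0 < moment ω n :=
  lt_of_lt_of_le (mul_pos (by positivity) (h.tail_pos (1 / 2) ⟨by norm_num, by norm_num⟩))
    (h.pow_mul_tail_le_moment n (by norm_num) (by norm_num))

lemma IsRadialWeight.moment_anti {ω : ℝ → ℝ} (h : IsRadialWeight ω) {m n : ℕ} (hmn : m ≤ n) :
    moment ω n ≤ moment ω m := by
  have := h.integral_pow_mul_le (m := m) (n := n) (c := 1) le_rfl zero_le_one le_rfl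
    (fun s hs hs1 => by simpa using pow_le_pow_of_le_one hs.le hs1.le hmn)
  simpa [moment] using this

lemma moment_zero (ω : ℝ → ℝ) : moment ω 0 = tail ω 0 := by
  simp [moment, tail]

/-- Splitting the moment at `r`. -/
lemma IsRadialWeight.moment_le_add {ω : ℝ → ℝ} (h : IsRadialWeight ω) {m n : ℕ} (hmn : m ≤ n)
    {r : ℝ} (hr : 0 ≤ r) (hr1 : r ≤ 1) :
    moment ω n ≤ r ^ (n - m) * moment ω m + tail ω r := by
  rw [h.moment_eq_add n hr hr1]
  have h1 : ∫ s in (0 : ℝ)..r, s ^ n * ω s ≤ r ^ (n - m) * moment ω m := by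
    refine (h.integral_pow_mul_le (m := m) (c := r ^ (n - m)) le_rfl hr hr1
      (fun s hs hs1 => ?_)).trans ?_
    · calc s ^ n = s ^ (n - m) * s ^ m := by rw [← pow_add, Nat.sub_add_cancel hmn]
        _ ≤ r ^ (n - m) * s ^ m := by gcongr
    · refine mul_le_mul_of_nonneg_left ?_ (by positivity)
      rw [h.moment_eq_add m hr hr1]
      linarith [h.integral_pow_mul_nonneg m hr hr1 le_rfl]
  have h2 : ∫ s in r..1, s ^ n * ω s ≤ tail ω r := by
    have := h.integral_pow_mul_le (m := 0) (n := n) (c := 1) hr hr1 le_rfl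
      (fun s hs hs1 => by simpa using pow_le_one₀ (hr.trans hs.le) hs1.le)
    simpa [tail] using this
  linarith

/-! ### Consequences of upper doubling -/

/-- Iterated doubling. -/
lemma IsUpperDoubling.exists_tail_le_pow_mul_tail {ω : ℝ → ℝ} (h : IsUpperDoubling ω) :
    ∃ C : ℝ, 1 ≤ C ∧ ∀ (j : ℕ) (s t : ℝ), 0 ≤ s → s < 1 → 0 ≤ t → t < 1 →
      1 - t ≤ 2 ^ j * (1 - s) → tail ω t ≤ C ^ j * tail ω s := by
  obtain ⟨C, hC, hd⟩ := h.doubling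
  have hr := h.toIsRadialWeight
  refine ⟨max C 1, le_max_right _ _, fun j => ?_⟩
  induction j with
  | zero =>
    intro s t hs hs1 ht ht1 hst
    simpa using hr.tail_anti hs (by linarith) ht1.le
  | succ j ih =>
    intro s t hs hs1 ht ht1 hst
    have h1 := hd t ⟨ht, ht1⟩
    have h2 := ih s ((1 + t) / 2) hs hs1 (by linarith) (by linarith) (by
      rw [pow_succ] at hst; linarith)
    calc tail ω t ≤ C * tail ω ((1 + t) / 2) := h1
      _ ≤ max C 1 * (max C 1 ^ j * tail ω s) := by
        refine mul_le_mul (le_max_left _ _) h2 ?_ (by positivity)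
        exact (hr.tail_pos _ ⟨by linarith, by linarith⟩).le
      _ = max C 1 ^ (j + 1) * tail ω s := by ring

/-- The moments of a weight in `𝒟̂` are controlled by its tails. -/
lemma IsUpperDoubling.exists_moment_le_tail {ω : ℝ → ℝ} (h : IsUpperDoubling ω) :
    ∃ A : ℝ, 0 < A ∧ ∀ n : ℕ, 1 ≤ n → moment ω n ≤ A * tail ω (1 - 1 / n) := by
  obtain ⟨C, hC, hd⟩ := h.exists_tail_le_pow_mul_tail
  have hr := h.toIsRadialWeight
  -- The moment is cut at `1 - 2^j/n`. Below the cut, half of the powers of `s` gain `exp(-2^j/2)`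
  -- against the moment of order `n/2`; two doublings, at cost `C^2`, bring the inductive tail back
  -- to `1 - 1/n`. This `j` makes that part at most half of the claimed bound `2 * C ^ j`; the part
  -- above the cut, by `j` doublings, is the other half.
  obtain ⟨j, hj0, hj⟩ : ∃ j : ℕ, 1 ≤ j ∧ C ^ 2 * Real.exp (-(2 ^ j / 2)) ≤ 1 / 2 := by
    have h1 : Filter.Tendsto (fun j : ℕ => C ^ 2 * Real.exp (-((2 : ℝ) ^ j / 2))) Filter.atTop
        (nhds (C ^ 2 * 0)) :=
      (Real.tendsto_exp_neg_atTop_nhds_zero.comp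
        ((tendsto_pow_atTop_atTop_of_one_lt one_lt_two).atTop_div_const two_pos)).const_mul _
    rw [mul_zero] at h1
    obtain ⟨j, hj1, hj2⟩ := ((h1.eventually_le_const (show (0 : ℝ) < 1 / 2 by norm_num)).and
      (Filter.eventually_ge_atTop 1)).exists
    exact ⟨j, hj2, hj1⟩
  refine ⟨2 * C ^ j, by positivity, fun n => ?_⟩
  induction n using Nat.strong_induction_on with
  | _ n ih =>
  intro hn
  have hnR : (1 : ℝ) ≤ n := by exact_mod_cast hn
  have hn0 : (0 : ℝ) < n := by linarith
  have hs0 : (0 : ℝ) ≤ 1 - 1 / n := by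
    rw [sub_nonneg, div_le_one hn0]; exact hnR
  have hs1 : (1 : ℝ) - 1 / n < 1 := by
    have : (0 : ℝ) < 1 / n := by positivity
    linarith
  have hT := hr.tail_pos _ ⟨hs0, hs1⟩
  rcases lt_or_ge (n : ℝ) (2 ^ j) with hlt | hge
  · have h1 : moment ω n ≤ tail ω 0 := by
      rw [← moment_zero]; exact hr.moment_anti (Nat.zero_le n)
    have h2 := hd j (1 - 1 / n) 0 hs0 hs1 le_rfl one_pos (by
      rw [sub_sub_cancel, mul_one_div, le_div_iff₀ hn0]; linarith)
    have h3 : C ^ j * tail ω (1 - 1 / n) ≤ 2 * C ^ j * tail ω (1 - 1 / n) := by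
      have : 0 ≤ C ^ j * tail ω (1 - 1 / n) := by positivity
      linarith
    linarith
  · have hn2 : 2 ≤ n := by
      have : (2 : ℝ) ^ 1 ≤ 2 ^ j := pow_le_pow_right₀ one_le_two hj0
      have : (2 : ℝ) ≤ n := by linarith
      exact_mod_cast this
    obtain ⟨m, hm⟩ : ∃ m, m = n / 2 := ⟨_, rfl⟩
    have hm1 : 1 ≤ m := by omega
    have hmn : m < n := by omega
    have hm4 : n ≤ 4 * m := by omega
    have hm0 : (0 : ℝ) < m := by exact_mod_cast hm1
    have hq : (2 : ℝ) ^ j / n ≤ 1 := by rwa [div_le_one hn0]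
    have hq0 : (0 : ℝ) < 2 ^ j / n := by positivity
    have h1 := hr.moment_le_add hmn.le (r := 1 - 2 ^ j / n) (by linarith) (by linarith)
    have h2 : tail ω (1 - 2 ^ j / n) ≤ C ^ j * tail ω (1 - 1 / n) :=
      hd j _ _ hs0 hs1 (by linarith) (by linarith) (by rw [sub_sub_cancel, sub_sub_cancel,
        mul_one_div])
    have h3 : (1 - (2 : ℝ) ^ j / n) ^ (n - m) ≤ Real.exp (-(2 ^ j / 2)) := by
      calc (1 - (2 : ℝ) ^ j / n) ^ (n - m) ≤ (Real.exp (-(2 ^ j / n))) ^ (n - m) := by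
            refine pow_le_pow_left₀ (by linarith) ?_ _
            have := Real.add_one_le_exp (-((2 : ℝ) ^ j / n))
            linarith
        _ = Real.exp ((n - m : ℕ) * (-(2 ^ j / n))) := by rw [Real.exp_nat_mul]
        _ ≤ _ := by
            rw [Real.exp_le_exp, mul_neg, neg_le_neg_iff, Nat.cast_sub hmn.le]
            have : (2 : ℝ) * m ≤ n := by exact_mod_cast (by omega : 2 * m ≤ n)
            rw [div_le_iff₀ two_pos, mul_assoc, div_mul_eq_mul_div, mul_div_assoc',
              le_div_iff₀ hn0]
            have h2j : (0 : ℝ) ≤ 2 ^ j := by positivity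
            nlinarith
    have h4 : moment ω m ≤ 2 * C ^ j * (C ^ 2 * tail ω (1 - 1 / n)) := by
      refine (ih m hmn hm1).trans (mul_le_mul_of_nonneg_left ?_ (by positivity))
      have hm1' : (1 : ℝ) / m ≤ 1 := by
        rw [div_le_one hm0]; exact_mod_cast hm1
      have : (0 : ℝ) < 1 / m := by positivity
      refine hd 2 _ _ hs0 hs1 (by linarith) (by linarith) ?_
      rw [sub_sub_cancel, sub_sub_cancel, mul_one_div, div_le_div_iff₀ hm0 hn0]
      have : (n : ℝ) ≤ 4 * m := by exact_mod_cast hm4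
      linarith
    have h5 : (1 - (2 : ℝ) ^ j / n) ^ (n - m) * moment ω m ≤ C ^ j * tail ω (1 - 1 / n) := by
      calc _ ≤ Real.exp (-(2 ^ j / 2)) * (2 * C ^ j * (C ^ 2 * tail ω (1 - 1 / n))) :=
            mul_le_mul h3 h4 (hr.moment_pos m).le (Real.exp_pos _).le
        _ = (C ^ 2 * Real.exp (-(2 ^ j / 2))) * (2 * (C ^ j * tail ω (1 - 1 / n))) := by ring
        _ ≤ 1 / 2 * (2 * (C ^ j * tail ω (1 - 1 / n))) :=
            mul_le_mul_of_nonneg_right hj (by positivity)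
        _ = _ := by ring
    linarith

/-- Bernoulli's inequality gives `(1 - 1/(2n))^n ≥ 1/2`, so beyond this point the factor `s^n` costs
at most 2. No doubling is involved. -/
lemma IsRadialWeight.tail_le_two_mul_moment {ω : ℝ → ℝ} (h : IsRadialWeight ω) {n : ℕ}
    (hn : 1 ≤ n) : tail ω (1 - 1 / (2 * n)) ≤ 2 * moment ω n := by
  have hnR : (1 : ℝ) ≤ n := by exact_mod_cast hn
  have hq : (1 : ℝ) / (2 * n) ≤ 1 / 2 := by
    apply one_div_le_one_div_of_le two_pos; linarith
  have hq0 : (0 : ℝ) < 1 / (2 * n) := by positivity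
  have h1 := h.pow_mul_tail_le_moment n (r := 1 - 1 / (2 * n)) (by linarith) (by linarith)
  have h2 : (1 : ℝ) / 2 ≤ (1 - 1 / (2 * n)) ^ n := by
    have := one_add_mul_le_pow (a := -((1 : ℝ) / (2 * n))) (by linarith) n
    have h3 : (n : ℝ) * (1 / (2 * n)) = 1 / 2 := by field_simp
    rw [mul_neg, h3] at this
    rw [sub_eq_add_neg]
    linarith
  have h3 := (h.tail_pos (1 - 1 / (2 * n)) ⟨by linarith, by linarith⟩).le
  nlinarith

/-- Tails are dominated by moments up to a polynomial factor. -/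
lemma IsUpperDoubling.exists_tail_le_moment {ω : ℝ → ℝ} (h : IsUpperDoubling ω) :
    ∃ (C : ℝ) (K : ℕ), 0 < C ∧ ∀ (n : ℕ) (t : ℝ), 0 ≤ t → t < 1 →
      tail ω t ≤ C * (1 + n * (1 - t)) ^ K * moment ω (2 * n + 3) := by
  obtain ⟨C, hC, hd⟩ := h.exists_tail_le_pow_mul_tail
  have hr := h.toIsRadialWeight
  obtain ⟨K, hK⟩ := pow_unbounded_of_one_lt C one_lt_two
  refine ⟨2 * 2 ^ K * 7 ^ K, K, by positivity, fun n t ht ht1 => ?_⟩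
  obtain ⟨x, hx⟩ : ∃ x : ℝ, x = 2 * (2 * n + 3) * (1 - t) := ⟨_, rfl⟩
  have ht' : 0 < 1 - t := by linarith
  have hx0 : 0 ≤ x := by rw [hx]; positivity
  -- Here `x` is the ratio of `1 - t` to `1/(2(2n+3))`, so `j + 1` doublings join the two points.
  -- Since `C < 2^K` and `2^j ≤ x + 1 ≤ 7(1 + n(1-t))`, the cost `C^(j+1)` is polynomial in `1 +
  -- n(1-t)`.
  obtain ⟨j, hj1, hj2⟩ := exists_nat_pow_near (show (1 : ℝ) ≤ x + 1 by linarith) one_lt_two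
  have hm : (1 : ℝ) / (2 * (2 * n + 3 : ℕ)) ≤ 1 / 2 := by
    apply one_div_le_one_div_of_le two_pos
    push_cast
    have : (0 : ℝ) ≤ n := by positivity
    linarith
  have hm0 : (0 : ℝ) < 1 / (2 * (2 * n + 3 : ℕ)) := by positivity
  have h1 := hd (j + 1) (1 - 1 / (2 * (2 * n + 3 : ℕ))) t (by linarith) (by linarith) ht ht1 (by
    rw [sub_sub_cancel, mul_one_div, le_div_iff₀ (by positivity)]
    push_cast
    linarith)
  have h2 := hr.tail_le_two_mul_moment (n := 2 * n + 3) (by omega)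
  have hM := hr.moment_pos (2 * n + 3)
  have h3 : C ^ (j + 1) ≤ 2 ^ K * 7 ^ K * (1 + n * (1 - t)) ^ K := by
    calc C ^ (j + 1) ≤ (2 ^ K) ^ (j + 1) := pow_le_pow_left₀ (by linarith) hK.le _
      _ = 2 ^ K * (2 ^ j) ^ K := by rw [← pow_mul, ← pow_mul]; ring
      _ ≤ 2 ^ K * (7 * (1 + n * (1 - t))) ^ K := by
        have hx7 : x + 1 ≤ 7 * (1 + n * (1 - t)) := by
          rw [hx]
          have : 0 ≤ n * (1 - t) := by positivity
          linarith
        gcongr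
        exact hj1.trans hx7
      _ = _ := by rw [mul_pow]; ring
  calc tail ω t ≤ C ^ (j + 1) * (2 * moment ω (2 * n + 3)) :=
        h1.trans (mul_le_mul_of_nonneg_left h2 (by positivity))
    _ ≤ 2 ^ K * 7 ^ K * (1 + n * (1 - t)) ^ K * (2 * moment ω (2 * n + 3)) :=
        mul_le_mul_of_nonneg_right h3 (by positivity)
    _ = _ := by ring

/-- Each of the `n` terms of `∑_{i<n} s^i` is at least `s^n`, and `1 - s` times that sum is `1 -
s^n`. -/
lemma nat_mul_one_sub_mul_pow_le_one {s : ℝ} (hs : 0 ≤ s) (hs1 : s ≤ 1) (n : ℕ) :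
    n * (1 - s) * s ^ n ≤ 1 := by
  have h1 : (n : ℝ) * s ^ n ≤ ∑ i ∈ Finset.range n, s ^ i := by
    have := Finset.card_nsmul_le_sum (Finset.range n) (fun i => s ^ i) (s ^ n)
      (fun i hi => pow_le_pow_of_le_one hs hs1 (Finset.mem_range.1 hi).le)
    simpa using this
  have h2 := mul_neg_geom_sum s n
  have h3 := pow_nonneg hs n
  nlinarith

/-- The difference integrates `s^(2n+1) (1-s)(1+s) ω`. Spending `s^n` on `n(1-s)` leaves at most `2
ω_{n+1}`, and doubling bounds `ω_{n+1}` by a multiple of `ω_{2n+1}`. This regularity is what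
controls the increments of `n g n`. -/
lemma IsUpperDoubling.exists_mul_moment_sub_le {ω : ℝ → ℝ} (h : IsUpperDoubling ω) :
    ∃ C : ℝ, 0 < C ∧ ∀ n : ℕ,
      n * (moment ω (2 * n + 1) - moment ω (2 * n + 3)) ≤ C * moment ω (2 * n + 1) := by
  obtain ⟨C, hC, hd⟩ := h.exists_tail_le_pow_mul_tail
  obtain ⟨A, hA, hmt⟩ := h.exists_moment_le_tail
  have hr := h.toIsRadialWeight
  refine ⟨2 * (A * (C ^ 2 * 2)), by positivity, fun n => ?_⟩
  have h1 : n * (moment ω (2 * n + 1) - moment ω (2 * n + 3)) ≤ 2 * moment ω (n + 1) := by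
    rw [moment, moment, moment, ← intervalIntegral.integral_sub
      (hr.intervalIntegrable_pow_mul _ le_rfl zero_le_one le_rfl)
      (hr.intervalIntegrable_pow_mul _ le_rfl zero_le_one le_rfl),
      ← intervalIntegral.integral_const_mul, ← intervalIntegral.integral_const_mul]
    refine intervalIntegral.integral_mono_on_of_le_Ioo zero_le_one
      (((hr.intervalIntegrable_pow_mul _ le_rfl zero_le_one le_rfl).sub
        (hr.intervalIntegrable_pow_mul _ le_rfl zero_le_one le_rfl)).const_mul _)
      ((hr.intervalIntegrable_pow_mul _ le_rfl zero_le_one le_rfl).const_mul _) (fun s hs => ?_)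
    have h2 := nat_mul_one_sub_mul_pow_le_one hs.1.le hs.2.le n
    have h3 : n * (s ^ (2 * n + 1) * ω s - s ^ (2 * n + 3) * ω s) =
        (n * (1 - s) * s ^ n) * ((1 + s) * (s ^ (n + 1) * ω s)) := by ring
    have hω := hr.nonneg s ⟨hs.1.le, hs.2⟩
    have h0 := hs.1.le
    rw [h3]
    calc _ ≤ 1 * ((1 + s) * (s ^ (n + 1) * ω s)) := mul_le_mul_of_nonneg_right h2 (by positivity)
      _ ≤ _ := by
        rw [one_mul]
        exact mul_le_mul_of_nonneg_right (by linarith [hs.2]) (by positivity)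
  have h4 := hmt (n + 1) (by omega)
  have h5 := hr.tail_le_two_mul_moment (n := 2 * n + 1) (by omega)
  have e1 : (1 : ℝ) / (n + 1 : ℕ) ≤ 1 := by
    rw [div_le_one (by positivity)]; push_cast; linarith [Nat.cast_nonneg (α := ℝ) n]
  have e2 : (0 : ℝ) < 1 / (n + 1 : ℕ) := by positivity
  have e3 : (1 : ℝ) / (2 * (2 * n + 1 : ℕ)) ≤ 1 / 2 := by
    apply one_div_le_one_div_of_le two_pos; push_cast
    linarith [Nat.cast_nonneg (α := ℝ) n]
  have e4 : (0 : ℝ) < 1 / (2 * (2 * n + 1 : ℕ)) := by positivity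
  have h6 := hd 2 (1 - 1 / (2 * (2 * n + 1 : ℕ))) (1 - 1 / (n + 1 : ℕ)) (by linarith)
    (by linarith) (by linarith) (by linarith) (by
      rw [sub_sub_cancel, sub_sub_cancel, mul_one_div, div_le_div_iff₀ (by positivity)
        (by positivity)]
      push_cast
      linarith)
  have h7 : A * tail ω (1 - 1 / (n + 1 : ℕ)) ≤ A * (C ^ 2 * (2 * moment ω (2 * n + 1))) := by
    gcongr
    exact h6.trans (mul_le_mul_of_nonneg_left h5 (by positivity))
  linarith

/-! ### Fourier series with absolutely summable coefficients -/

lemma norm_exp_mul_I_pow (θ : ℝ) (n : ℕ) : ‖Complex.exp (θ * Complex.I) ^ n‖ = 1 := by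
  rw [norm_pow, Complex.norm_exp_ofReal_mul_I, one_pow]

lemma continuous_exp_mul_I : Continuous fun θ : ℝ => Complex.exp (θ * Complex.I) := by
  fun_prop

lemma summable_mul_pow_of_norm_le {c : ℕ → ℂ} {t : ℝ} (hc : Summable fun n => ‖c n‖ * t ^ n)
    {z : ℂ} (hz : ‖z‖ ≤ t) : Summable fun n => c n * z ^ n :=
  hc.of_norm_bounded (fun n => by
    rw [norm_mul, norm_pow]
    gcongr)

/-- The integral of a continuous function against an absolutely convergent Fourier series. -/
lemma hasSum_integral_mul_fourier {c : ℕ → ℂ} (hc : Summable fun n => ‖c n‖) {u : ℝ → ℂ}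
    (hu : Continuous u) (a b : ℝ) :
    HasSum (fun n => c n * ∫ θ in a..b, u θ * Complex.exp (θ * Complex.I) ^ n)
      (∫ θ in a..b, u θ * ∑' n, c n * Complex.exp (θ * Complex.I) ^ n) := by
  have h := intervalIntegral.hasSum_integral_of_dominated_convergence (μ := volume) (a := a) (b := b)
    (F := fun n θ => c n * (u θ * Complex.exp (θ * Complex.I) ^ n))
    (f := fun θ : ℝ => u θ * ∑' n, c n * Complex.exp (θ * Complex.I) ^ n)
    (fun n θ => ‖c n‖ * ‖u θ‖)
    (fun n => by
      have := continuous_exp_mul_I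
      exact Continuous.aestronglyMeasurable (by fun_prop))
    (fun n => Filter.Eventually.of_forall fun θ _ => by
      rw [norm_mul, norm_mul, norm_exp_mul_I_pow, mul_one])
    (Filter.Eventually.of_forall fun θ _ => hc.mul_right _)
    (by
      simp_rw [tsum_mul_right]
      exact (hu.norm.const_mul _).intervalIntegrable _ _)
    (Filter.Eventually.of_forall fun θ _ => by
      have h1 : Summable fun n => c n * Complex.exp (θ * Complex.I) ^ n :=
        hc.of_norm_bounded (fun n => by rw [norm_mul, norm_exp_mul_I_pow, mul_one])
      refine (h1.hasSum.mul_left (u θ)).congr_fun ?_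
      intro n
      ring)
  simpa only [intervalIntegral.integral_const_mul] using h

lemma continuous_fourier {c : ℕ → ℂ} (hc : Summable fun n => ‖c n‖) :
    Continuous fun θ : ℝ => ∑' n, c n * Complex.exp (θ * Complex.I) ^ n := by
  refine continuous_tsum (fun n => ?_) hc (fun n θ => ?_)
  · have := continuous_exp_mul_I
    fun_prop
  · rw [norm_mul, norm_exp_mul_I_pow, mul_one]

lemma integral_conj_exp_pow_mul_exp_pow (m n : ℕ) :
    ∫ θ in (0 : ℝ)..2 * π, conj (Complex.exp (θ * Complex.I)) ^ m *
      Complex.exp (θ * Complex.I) ^ n = if n = m then 2 * π else 0 := by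
  have h1 : ∀ θ : ℝ, conj (Complex.exp (θ * Complex.I)) ^ m * Complex.exp (θ * Complex.I) ^ n =
      Complex.exp ((((n : ℂ) - m) * Complex.I) * θ) := fun θ => by
    rw [← Complex.exp_conj, ← Complex.exp_nat_mul, ← Complex.exp_nat_mul, ← Complex.exp_add]
    congr 1
    simp only [map_mul, Complex.conj_ofReal, Complex.conj_I]
    ring
  simp_rw [h1]
  split_ifs with h
  · simp [h]
  · have hc : ((n : ℂ) - m) * Complex.I ≠ 0 :=
      mul_ne_zero (sub_ne_zero.2 (by exact_mod_cast h)) Complex.I_ne_zero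
    rw [integral_exp_mul_complex hc]
    have h2 : ((n : ℂ) - m) * Complex.I * ((2 * π : ℝ) : ℂ) =
        (((n : ℤ) - m : ℤ) : ℂ) * (2 * π * Complex.I) := by
      push_cast
      ring
    rw [h2, Complex.exp_int_mul_two_pi_mul_I]
    simp

/-- The Fourier coefficients of an absolutely convergent Fourier series. -/
lemma integral_conj_exp_pow_mul_fourier {c : ℕ → ℂ} (hc : Summable fun n => ‖c n‖) (m : ℕ) :
    ∫ θ in (0 : ℝ)..2 * π, conj (Complex.exp (θ * Complex.I)) ^ m *
      ∑' n, c n * Complex.exp (θ * Complex.I) ^ n = 2 * π * c m := by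
  have hu : Continuous fun θ : ℝ => conj (Complex.exp (θ * Complex.I)) ^ m :=
    (Complex.continuous_conj.comp continuous_exp_mul_I).pow m
  have h := hasSum_integral_mul_fourier hc hu 0 (2 * π)
  simp_rw [integral_conj_exp_pow_mul_exp_pow] at h
  refine h.unique ?_
  convert hasSum_ite_eq m (2 * π * c m : ℂ) using 2 with n
  split_ifs with hn
  · rw [hn]
    push_cast
    ring
  · simp

/-- Parseval's identity. -/
lemma hasSum_parseval {c : ℕ → ℂ} (hc : Summable fun n => ‖c n‖) :
    HasSum (fun n => ‖c n‖ ^ 2) ((2 * π)⁻¹ *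
      ∫ θ in (0 : ℝ)..2 * π, ‖∑' n, c n * Complex.exp (θ * Complex.I) ^ n‖ ^ 2) := by
  have hu := Complex.continuous_conj.comp (continuous_fourier hc)
  have h := hasSum_integral_mul_fourier hc hu 0 (2 * π)
  have h1 : ∀ m : ℕ, ∫ θ in (0 : ℝ)..2 * π,
      (conj ∘ fun θ : ℝ => ∑' n, c n * Complex.exp (θ * Complex.I) ^ n) θ *
        Complex.exp (θ * Complex.I) ^ m = 2 * π * conj (c m) := fun m => by
    have h2 := congrArg conj (integral_conj_exp_pow_mul_fourier hc m)
    rw [← intervalIntegral.intervalIntegral_conj] at h2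
    simp only [map_mul, map_pow, Complex.conj_conj, Complex.conj_ofReal, map_ofNat] at h2
    rw [← h2]
    refine intervalIntegral.integral_congr (fun θ _ => ?_)
    simp only [Function.comp_apply]
    ring
  simp_rw [h1] at h
  have h3 : ∀ θ : ℝ, (conj ∘ fun θ : ℝ => ∑' n, c n * Complex.exp (θ * Complex.I) ^ n) θ *
      (∑' n, c n * Complex.exp (θ * Complex.I) ^ n) =
      ((‖∑' n, c n * Complex.exp (θ * Complex.I) ^ n‖ ^ 2 : ℝ) : ℂ) := fun θ => by
    simp only [Function.comp_apply]
    rw [Complex.conj_mul']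
    push_cast
    rfl
  simp_rw [h3] at h
  rw [intervalIntegral.integral_ofReal] at h
  have h4 : ∀ n, c n * (2 * π * conj (c n)) = ((2 * π * ‖c n‖ ^ 2 : ℝ) : ℂ) := fun n => by
    rw [mul_left_comm, Complex.mul_conj']
    push_cast
    ring
  simp_rw [h4] at h
  have h5 := (Complex.hasSum_ofReal.1 h).mul_left (2 * π)⁻¹
  refine h5.congr_fun (fun n => ?_)
  field_simp

/-! ### The lower bound: Hardy's inequality for positive coefficients -/

/-- The sawtooth function behind Hardy's inequality. -/
def hardyWeight (θ : ℝ) : ℂ := (1 - Complex.I) + Complex.I * (θ / π)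

lemma continuous_hardyWeight : Continuous hardyWeight := by
  unfold hardyWeight
  fun_prop

lemma norm_hardyWeight_le {θ : ℝ} (h0 : 0 ≤ θ) (h1 : θ ≤ 2 * π) : ‖hardyWeight θ‖ ≤ 2 := by
  have h2 : hardyWeight θ = 1 + Complex.I * ((θ / π - 1 : ℝ) : ℂ) := by
    unfold hardyWeight
    push_cast
    ring
  rw [h2]
  refine (norm_add_le _ _).trans ?_
  rw [norm_mul, Complex.norm_I, one_mul, Complex.norm_real, norm_one, Real.norm_eq_abs]
  have h3 : θ / π ≤ 2 := by rwa [div_le_iff₀ Real.pi_pos]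
  have h4 : 0 ≤ θ / π := by positivity
  have : |θ / π - 1| ≤ 1 := abs_le.2 ⟨by linarith, by linarith⟩
  linarith

lemma integral_hardyWeight : ∫ θ in (0 : ℝ)..2 * π, hardyWeight θ = 2 * π := by
  have h : ∀ θ : ℝ, HasDerivAt
      (fun θ : ℝ => (1 - Complex.I) * θ + Complex.I * ((θ : ℂ) ^ 2 / (2 * π)))
      (hardyWeight θ) θ := fun θ => by
    have h1 : HasDerivAt (fun z : ℂ => (1 - Complex.I) * z + Complex.I * (z ^ 2 / (2 * π)))
        (hardyWeight θ) (θ : ℂ) := by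
      have := ((hasDerivAt_id (θ : ℂ)).const_mul (1 - Complex.I)).add
        ((((hasDerivAt_id (θ : ℂ)).pow 2).div_const (2 * π : ℂ)).const_mul Complex.I)
      refine this.congr_deriv ?_
      unfold hardyWeight
      simp
      ring
    exact h1.comp_ofReal
  rw [intervalIntegral.integral_eq_sub_of_hasDerivAt (fun θ _ => h θ)
    (continuous_hardyWeight.intervalIntegrable _ _)]
  have : (π : ℂ) ≠ 0 := by exact_mod_cast Real.pi_ne_zero
  push_cast
  field_simp
  ring

/-- The weight is `1 + I(θ/π - 1)`: the real part sees only frequency 0, while the mean-zero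
sawtooth produces `2/m` at every frequency `m ≥ 1`, here `m = n + 1`. The primitive comes from
integration by parts. -/
lemma integral_hardyWeight_mul_exp_pow (n : ℕ) :
    ∫ θ in (0 : ℝ)..2 * π, hardyWeight θ * Complex.exp (θ * Complex.I) ^ (n + 1) =
      2 / (n + 1) := by
  have hn : (n : ℂ) + 1 ≠ 0 := by exact_mod_cast n.succ_ne_zero
  have hπ : (π : ℂ) ≠ 0 := by exact_mod_cast Real.pi_ne_zero
  have h : ∀ θ : ℝ, HasDerivAt
      (fun θ : ℝ => ((1 - Complex.I) + Complex.I * (θ / π)) *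
        (Complex.exp ((n + 1) * Complex.I * θ) / ((n + 1) * Complex.I)) +
        Complex.I / π * (Complex.exp ((n + 1) * Complex.I * θ) / (n + 1) ^ 2))
      (hardyWeight θ * Complex.exp (θ * Complex.I) ^ (n + 1)) θ := fun θ => by
    have he : HasDerivAt (fun z : ℂ => Complex.exp ((n + 1) * Complex.I * z))
        (Complex.exp ((n + 1) * Complex.I * θ) * ((n + 1) * Complex.I)) (θ : ℂ) := by
      simpa using ((hasDerivAt_id (θ : ℂ)).const_mul ((n + 1) * Complex.I)).cexp
    have hl : HasDerivAt (fun z : ℂ => (1 - Complex.I) + Complex.I * (z / π))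
        (Complex.I * (1 / π)) (θ : ℂ) :=
      (((hasDerivAt_id (θ : ℂ)).div_const (π : ℂ)).const_mul Complex.I).const_add _
    have h1 := ((hl.mul (he.div_const ((n + 1) * Complex.I))).add
      ((he.div_const ((n + 1 : ℂ) ^ 2)).const_mul (Complex.I / π))).comp_ofReal
    refine h1.congr_deriv ?_
    rw [← Complex.exp_nat_mul]
    have h2 : ((n + 1 : ℕ) : ℂ) * (θ * Complex.I) = (n + 1) * Complex.I * θ := by
      push_cast
      ring
    rw [h2]
    unfold hardyWeight
    have hI := Complex.I_ne_zero
    field_simp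
    linear_combination Complex.I_sq
  rw [intervalIntegral.integral_eq_sub_of_hasDerivAt (fun θ _ => h θ)
    (Continuous.intervalIntegrable (by
      have := continuous_exp_mul_I
      have := continuous_hardyWeight
      fun_prop) _ _)]
  have h2 : ((n : ℂ) + 1) * Complex.I * ((2 * π : ℝ) : ℂ) =
      ((n + 1 : ℕ) : ℂ) * (2 * π * Complex.I) := by
    push_cast
    ring
  rw [h2, Complex.exp_nat_mul_two_pi_mul_I]
  have hI := Complex.I_ne_zero
  simp
  field_simp
  linear_combination (-2 : ℂ) * Complex.I_sq

/-- Hardy's inequality for nonnegative coefficients. -/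
lemma hardy_inequality {g : ℕ → ℝ} (hg : ∀ n, 0 ≤ g n) (hs : Summable g) :
    g 0 + π⁻¹ * ∑' n, g (n + 1) / (n + 1) ≤ 2 * ((2 * π)⁻¹ *
      ∫ θ in (0 : ℝ)..2 * π, ‖∑' n, (g n : ℂ) * Complex.exp (θ * Complex.I) ^ n‖) := by
  have hc : Summable fun n => ‖(g n : ℂ)‖ := by
    simpa [abs_of_nonneg (hg _)] using hs
  -- Duality: pair the series with a weight of modulus at most 2. The result is the real number `2π
  -- g 0 + 2 ∑ g (n+1)/(n+1)`, hence at most its modulus.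
  have h := (hasSum_integral_mul_fourier hc continuous_hardyWeight 0 (2 * π)).tsum_eq
  have hsum := (hasSum_integral_mul_fourier hc continuous_hardyWeight 0 (2 * π)).summable
  rw [hsum.tsum_eq_zero_add] at h
  simp only [pow_zero, mul_one, integral_hardyWeight, integral_hardyWeight_mul_exp_pow] at h
  have h1 : ∀ n : ℕ, (g (n + 1) : ℂ) * (2 / (n + 1)) = ((2 * (g (n + 1) / (n + 1)) : ℝ) : ℂ) :=
    fun n => by push_cast; ring
  simp_rw [h1] at h
  rw [← Complex.ofReal_tsum, tsum_mul_left] at h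
  have h2 : ‖∫ θ in (0 : ℝ)..2 * π,
      hardyWeight θ * ∑' n, (g n : ℂ) * Complex.exp (θ * Complex.I) ^ n‖ ≤
      ∫ θ in (0 : ℝ)..2 * π, 2 * ‖∑' n, (g n : ℂ) * Complex.exp (θ * Complex.I) ^ n‖ := by
    have hcont := continuous_fourier hc
    refine (intervalIntegral.norm_integral_le_integral_norm Real.two_pi_pos.le).trans ?_
    refine intervalIntegral.integral_mono_on Real.two_pi_pos.le
      ((continuous_hardyWeight.mul hcont).norm.intervalIntegrable _ _)
      ((hcont.norm.const_mul _).intervalIntegrable _ _) (fun θ hθ => ?_)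
    rw [norm_mul]
    exact mul_le_mul_of_nonneg_right (norm_hardyWeight_le hθ.1 hθ.2) (norm_nonneg _)
  rw [← h, intervalIntegral.integral_const_mul] at h2
  have h3 : (g 0 : ℂ) * (2 * π) + ((2 * ∑' n, g (n + 1) / ((n : ℝ) + 1) : ℝ) : ℂ) =
      ((2 * π * (g 0 + π⁻¹ * ∑' n, g (n + 1) / ((n : ℝ) + 1)) : ℝ) : ℂ) := by
    have hπ : (π : ℂ) ≠ 0 := by exact_mod_cast Real.pi_ne_zero
    push_cast
    field_simp
  rw [h3, Complex.norm_real] at h2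
  have h4 := (le_abs_self _).trans h2
  calc _ = (2 * π)⁻¹ * (2 * π * (g 0 + π⁻¹ * ∑' n, g (n + 1) / ((n : ℝ) + 1))) := by
        field_simp
    _ ≤ (2 * π)⁻¹ * _ := mul_le_mul_of_nonneg_left h4 (by positivity)
    _ = _ := by ring

/-- Termwise integration of a power series over `[0, ρ]`. -/
lemma hasSum_integral_powerSeries {c : ℕ → ℂ} {ρ : ℝ} (hρ : 0 ≤ ρ)
    (hc : Summable fun n => ‖c n‖ * ρ ^ n) {w : ℂ} (hw : ‖w‖ ≤ 1) :
    HasSum (fun n : ℕ => c n * w ^ n * (ρ ^ (n + 1) / (n + 1)))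
      (∫ t in (0 : ℝ)..ρ, ∑' n, c n * (t * w) ^ n) := by
  have h := intervalIntegral.hasSum_integral_of_dominated_convergence (μ := volume) (a := 0) (b := ρ)
    (F := fun n t => c n * w ^ n * ((t ^ n : ℝ) : ℂ))
    (f := fun t : ℝ => ∑' n, c n * (t * w) ^ n)
    (fun n _ => ‖c n‖ * ρ ^ n)
    (fun n => Continuous.aestronglyMeasurable (by fun_prop))
    (fun n => Filter.Eventually.of_forall fun t ht => by
      rw [uIoc_of_le hρ] at ht
      rw [norm_mul, norm_mul, norm_pow, Complex.norm_real, norm_pow, Real.norm_eq_abs,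
        abs_of_pos ht.1]
      have h1 : ‖w‖ ^ n ≤ 1 := pow_le_one₀ (norm_nonneg _) hw
      have h2 : t ^ n ≤ ρ ^ n := pow_le_pow_left₀ ht.1.le ht.2 n
      calc ‖c n‖ * ‖w‖ ^ n * t ^ n ≤ ‖c n‖ * 1 * ρ ^ n := by
            gcongr
            exact pow_nonneg ht.1.le n
        _ = _ := by ring)
    (Filter.Eventually.of_forall fun t _ => hc)
    intervalIntegrable_const
    (Filter.Eventually.of_forall fun t ht => by
      rw [uIoc_of_le hρ] at ht
      have h1 : Summable fun n => c n * ((t : ℂ) * w) ^ n := by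
        refine summable_mul_pow_of_norm_le hc ?_
        rw [norm_mul, Complex.norm_real, Real.norm_eq_abs, abs_of_pos ht.1]
        nlinarith [ht.1, ht.2]
      refine h1.hasSum.congr_fun (fun n => ?_)
      push_cast
      ring)
  refine h.congr_fun (fun n => ?_)
  rw [intervalIntegral.integral_const_mul, intervalIntegral.integral_ofReal, integral_pow]
  simp

lemma summable_nat_succ_pow_mul_geometric (K : ℕ) {t : ℝ} (ht : 0 ≤ t) (ht1 : t < 1) :
    Summable fun n : ℕ => ((n : ℝ) + 1) ^ K * t ^ n := by
  -- The index shift is undone by dividing by `s`, so a positive `s` replaces `t`, which may be 0.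
  obtain ⟨s, hs, hs0, hs1⟩ : ∃ s, t ≤ s ∧ 0 < s ∧ s < 1 :=
    ⟨(1 + t) / 2, by linarith, by linarith, by linarith⟩
  have h := (summable_nat_add_iff 1).2 (summable_pow_mul_geometric_of_norm_lt_one K
    (r := s) (by rwa [Real.norm_eq_abs, abs_of_pos hs0]))
  refine (h.mul_left s⁻¹).of_nonneg_of_le (fun n => by positivity) (fun n => ?_)
  calc ((n : ℝ) + 1) ^ K * t ^ n ≤ ((n : ℝ) + 1) ^ K * s ^ n := by gcongr
    _ = s⁻¹ * (((n + 1 : ℕ) : ℝ) ^ K * s ^ (n + 1)) := by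
      push_cast
      field_simp
      ring

/-! ### Integral means of power series with regular coefficients -/

lemma summable_coeff_mul_pow {g : ℕ → ℝ} (hg : ∀ n, 0 ≤ g n) {B : ℝ} {K : ℕ}
    (hB : ∀ n : ℕ, g n ≤ B * ((n : ℝ) + 1) ^ K) {t : ℝ} (ht : 0 ≤ t) (ht1 : t < 1) :
    Summable fun n => g n * t ^ n := by
  refine ((summable_nat_succ_pow_mul_geometric K ht ht1).mul_left B).of_nonneg_of_le
    (fun n => mul_nonneg (hg n) (by positivity)) (fun n => ?_)
  rw [← mul_assoc]
  exact mul_le_mul_of_nonneg_right (hB n) (by positivity)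

lemma summable_succ_mul_coeff_succ_mul_pow {g : ℕ → ℝ} (hg : ∀ n, 0 ≤ g n) {B : ℝ} {K : ℕ}
    (hB : ∀ n : ℕ, g n ≤ B * ((n : ℝ) + 1) ^ K) {t : ℝ} (ht : 0 ≤ t) (ht1 : t < 1) :
    Summable fun n : ℕ => ((n : ℝ) + 1) * g (n + 1) * t ^ n := by
  have hB0 : 0 ≤ B := by
    have := (hg 0).trans (hB 0)
    simpa using this
  refine summable_coeff_mul_pow (B := B * 2 ^ K) (K := K + 1)
    (fun n => mul_nonneg (by positivity) (hg _)) (fun n => ?_) ht ht1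
  calc ((n : ℝ) + 1) * g (n + 1) ≤ ((n : ℝ) + 1) * (B * (2 * ((n : ℝ) + 1)) ^ K) := by
        gcongr
        refine (hB (n + 1)).trans ?_
        push_cast
        have : (0 : ℝ) ≤ n := n.cast_nonneg
        gcongr
        linarith
    _ = B * 2 ^ K * ((n : ℝ) + 1) ^ (K + 1) := by
        rw [mul_pow]
        ring

lemma summable_coeff_succ_mul_pow {g : ℕ → ℝ} (hg : ∀ n, 0 ≤ g n) {B : ℝ} {K : ℕ}
    (hB : ∀ n : ℕ, g n ≤ B * ((n : ℝ) + 1) ^ K) {t : ℝ} (ht : 0 ≤ t) (ht1 : t < 1) :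
    Summable fun n : ℕ => g (n + 1) * t ^ n :=
  (summable_succ_mul_coeff_succ_mul_pow hg hB ht ht1).of_nonneg_of_le
    (fun n => mul_nonneg (hg _) (by positivity)) (fun n => by
      refine mul_le_mul_of_nonneg_right ?_ (by positivity)
      have : (0 : ℝ) ≤ n := n.cast_nonneg
      nlinarith [hg (n + 1)])

lemma continuousOn_tsum_mul_pow {g : ℕ → ℝ} (hg : ∀ n, 0 ≤ g n) {ρ : ℝ}
    (hs : Summable fun n => g n * ρ ^ n) :
    ContinuousOn (fun t : ℝ => ∑' n, g n * t ^ n) (Icc 0 ρ) := by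
  refine continuousOn_tsum (fun n => by fun_prop) hs (fun n t ht => ?_)
  rw [norm_mul, norm_pow, Real.norm_eq_abs, Real.norm_eq_abs, abs_of_nonneg (hg n),
    abs_of_nonneg ht.1]
  exact mul_le_mul_of_nonneg_left (pow_le_pow_left₀ ht.1 ht.2 n) (hg n)

lemma integral_tsum_coeff_succ {g : ℕ → ℝ} (hg : ∀ n, 0 ≤ g n) {ρ : ℝ} (hρ : 0 ≤ ρ)
    (hs : Summable fun n => g (n + 1) * ρ ^ n) :
    ∫ t in (0 : ℝ)..ρ, ∑' n, g (n + 1) * t ^ n =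
      ∑' n : ℕ, g (n + 1) * ρ ^ (n + 1) / (n + 1) := by
  have h := (hasSum_integral_powerSeries (c := fun n => (g (n + 1) : ℂ)) hρ
    (by simpa [abs_of_nonneg (hg _)] using hs) (w := 1) (by simp)).tsum_eq
  have h1 : ∀ t : ℝ, ∑' n, (g (n + 1) : ℂ) * ((t : ℂ) * 1) ^ n =
      ((∑' n, g (n + 1) * t ^ n : ℝ) : ℂ) := fun t => by
    rw [Complex.ofReal_tsum]
    simp
  simp_rw [h1] at h
  rw [intervalIntegral.integral_ofReal] at h
  have h2 : ∀ n : ℕ, (g (n + 1) : ℂ) * 1 ^ n * ((ρ : ℂ) ^ (n + 1) / (n + 1)) =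
      ((g (n + 1) * ρ ^ (n + 1) / (n + 1) : ℝ) : ℂ) := fun n => by
    push_cast
    ring
  simp_rw [h2] at h
  rw [← Complex.ofReal_tsum] at h
  exact (Complex.ofReal_injective h).symm

/-- Keep only the indices from `k ≈ 1/(2(1-t))` on. There the coefficients are at least `a`, while
`t^k ≥ 1/2` by Bernoulli, so a full geometric series with factor `a/2` survives. -/
lemma le_tsum_coeff_succ {g : ℕ → ℝ} (hg : ∀ n, 0 ≤ g n) {t a : ℝ} (ht : 0 ≤ t) (ht1 : t < 1)
    (hs : Summable fun n => g (n + 1) * t ^ n)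
    (hlow : ∀ n : ℕ, 1 ≤ (2 * n + 1) * (1 - t) → a ≤ g n) :
    a / 2 / (1 - t) ≤ ∑' n, g (n + 1) * t ^ n := by
  have ht' : 0 < 1 - t := by linarith
  obtain ⟨k, hk1, hk2⟩ : ∃ k : ℕ, (k : ℝ) * (1 - t) ≤ 1 / 2 ∧ 1 / 2 ≤ (k + 1) * (1 - t) := by
    refine ⟨⌊1 / 2 / (1 - t)⌋₊, ?_, ?_⟩
    · rw [← le_div_iff₀ ht']
      exact Nat.floor_le (by positivity)
    · rw [← div_le_iff₀ ht']
      exact (Nat.lt_floor_add_one _).le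
  have hpow : 1 / 2 ≤ t ^ k := by
    have := one_add_mul_le_pow (a := t - 1) (by linarith) k
    rw [add_sub_cancel] at this
    linarith
  have hk : Summable fun n => g (n + k + 1) * t ^ (n + k) := (summable_nat_add_iff k).2 hs
  have hgeo := hasSum_geometric_of_lt_one ht ht1
  calc a / 2 / (1 - t) = ∑' n, a / 2 * t ^ n := by
        rw [tsum_mul_left, hgeo.tsum_eq, div_eq_mul_inv]
    _ ≤ ∑' n, g (n + k + 1) * t ^ (n + k) := by
        refine (hgeo.summable.mul_left _).tsum_le_tsum (fun n => ?_) hk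
        have h1 : a ≤ g (n + k + 1) := hlow _ (by
          push_cast
          have : 0 ≤ (n : ℝ) * (1 - t) := by positivity
          linarith)
        have htn : 0 ≤ t ^ n := by positivity
        rw [pow_add]
        calc a / 2 * t ^ n = a * (t ^ n * (1 / 2)) := by ring
          _ ≤ g (n + k + 1) * (t ^ n * t ^ k) :=
            mul_le_mul h1 (mul_le_mul_of_nonneg_left hpow htn) (by positivity) (hg _)
    _ ≤ ∑' n, g (n + 1) * t ^ n := by
        rw [← hs.sum_add_tsum_nat_add k]
        refine le_add_of_nonneg_left (Finset.sum_nonneg fun n _ => mul_nonneg (hg _) ?_)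
        positivity

/-- Mean value over the circle of radius `ρ` of the modulus of a power series. -/
def seriesMean (c : ℕ → ℝ) (ρ : ℝ) : ℝ :=
  (2 * π)⁻¹ * ∫ θ in (0 : ℝ)..2 * π, ‖∑' n, (c n : ℂ) * (ρ * Complex.exp (θ * Complex.I)) ^ n‖

lemma continuousOn_div_one_sub {h : ℝ → ℝ} (hh : ContinuousOn h (Ico 0 1)) {ρ : ℝ}
    (hρ1 : ρ < 1) : ContinuousOn (fun t => h t / (1 - t)) (Icc 0 ρ) := by
  refine (hh.mono fun t ht => ⟨ht.1, ht.2.trans_lt hρ1⟩).div (by fun_prop) (fun t ht => ?_)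
  linarith [ht.2]

/-- Lower bound for the integral mean of a power series with positive coefficients. -/
lemma le_seriesMean {g : ℕ → ℝ} {h : ℝ → ℝ} (hg : ∀ n, 0 ≤ g n) {B : ℝ} {K : ℕ}
    (hB : ∀ n : ℕ, g n ≤ B * ((n : ℝ) + 1) ^ K) (hh : ContinuousOn h (Ico 0 1))
    {c : ℝ}
    (hlow : ∀ (n : ℕ) (t : ℝ), 0 ≤ t → t < 1 → 1 ≤ (2 * n + 1) * (1 - t) → c * h t ≤ g n)
    {ρ : ℝ} (hρ : 0 ≤ ρ) (hρ1 : ρ < 1) :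
    g 0 + π⁻¹ * (c / 2 * ∫ t in (0 : ℝ)..ρ, h t / (1 - t)) ≤ 2 * seriesMean g ρ := by
  have h1 := hardy_inequality (g := fun n => g n * ρ ^ n)
    (fun n => mul_nonneg (hg n) (by positivity)) (summable_coeff_mul_pow hg hB hρ hρ1)
  have h2 : ∀ θ : ℝ, ∑' n, ((g n * ρ ^ n : ℝ) : ℂ) * Complex.exp (θ * Complex.I) ^ n =
      ∑' n, (g n : ℂ) * (ρ * Complex.exp (θ * Complex.I)) ^ n := fun θ => by
    refine tsum_congr fun n => ?_
    push_cast
    ring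
  simp_rw [h2] at h1
  have hs := summable_coeff_succ_mul_pow hg hB hρ hρ1
  rw [← integral_tsum_coeff_succ hg hρ hs, pow_zero, mul_one] at h1
  refine le_trans ?_ h1
  gcongr
  rw [← intervalIntegral.integral_const_mul]
  refine intervalIntegral.integral_mono_on hρ ?_ ?_ (fun t ht => ?_)
  · exact ((continuousOn_div_one_sub hh hρ1).const_mul _).intervalIntegrable_of_Icc hρ
  · exact (continuousOn_tsum_mul_pow (fun n => hg (n + 1)) hs).intervalIntegrable_of_Icc hρ
  · have ht1 := ht.2.trans_lt hρ1
    have h3 := le_tsum_coeff_succ hg ht.1 ht1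
      (summable_coeff_succ_mul_pow hg hB ht.1 ht1) (fun n hn => hlow n t ht.1 ht1 hn)
    calc _ = c * h t / 2 / (1 - t) := by ring
      _ ≤ _ := h3

/-- `(1 - z) G'(z)` has the coefficients `(n + 1) g (n + 1) - n g n`. -/
lemma one_sub_mul_tsum {g : ℕ → ℝ} {z : ℂ}
    (hs : Summable fun n : ℕ => (((n : ℝ) + 1) * g (n + 1) : ℝ) * z ^ n) :
    (1 - z) * ∑' n : ℕ, (((n : ℝ) + 1) * g (n + 1) : ℝ) * z ^ n =
      ∑' n : ℕ, (((n : ℝ) + 1) * g (n + 1) - n * g n : ℝ) * z ^ n := by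
  have h0 : Summable fun n : ℕ => (((n : ℝ) * g n : ℝ) : ℂ) * z ^ n := by
    refine (summable_nat_add_iff 1).1 ((hs.mul_left z).congr fun n => ?_)
    push_cast
    ring
  have h1 : z * ∑' n : ℕ, (((n : ℝ) + 1) * g (n + 1) : ℝ) * z ^ n =
      ∑' n : ℕ, (((n : ℝ) * g n : ℝ) : ℂ) * z ^ n := by
    rw [h0.tsum_eq_zero_add, ← tsum_mul_left]
    simp only [Nat.cast_zero, zero_mul, Complex.ofReal_zero, zero_add]
    refine tsum_congr fun n => ?_
    push_cast
    ring
  rw [sub_mul, one_mul, h1, ← hs.tsum_sub h0]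
  refine tsum_congr fun n => ?_
  push_cast
  ring

/-- With `x = 1 + n(1-t)` one has `x^K ≤ K! e^x` and `t^n ≤ e^(1-x)`. Thus one factor `t^n` absorbs
any polynomial in `n(1-t)`, uniformly in `t`. -/
lemma exists_one_add_pow_mul_pow_le (K : ℕ) : ∃ B : ℝ, 0 < B ∧ ∀ (n : ℕ) (t : ℝ), 0 ≤ t → t < 1 →
    (1 + n * (1 - t)) ^ K * t ^ n ≤ B := by
  refine ⟨K.factorial * Real.exp 1, by positivity, fun n t ht ht1 => ?_⟩
  have hx : 0 ≤ 1 + n * (1 - t) := by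
    have : 0 ≤ 1 - t := by linarith
    positivity
  have h1 := Real.pow_div_factorial_le_exp _ hx K
  rw [div_le_iff₀ (by positivity)] at h1
  have h2 : t ^ n ≤ Real.exp (-(n * (1 - t))) := by
    have h3 : t ≤ Real.exp (-(1 - t)) := by
      have := Real.add_one_le_exp (-(1 - t))
      linarith
    calc t ^ n ≤ Real.exp (-(1 - t)) ^ n := pow_le_pow_left₀ ht h3 n
      _ = _ := by rw [← Real.exp_nat_mul]; ring_nf
  calc _ ≤ (Real.exp (1 + n * (1 - t)) * K.factorial) * Real.exp (-(n * (1 - t))) :=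
        mul_le_mul h1 h2 (by positivity) (by positivity)
    _ = K.factorial * (Real.exp (1 + n * (1 - t)) * Real.exp (-(n * (1 - t)))) := by ring
    _ = _ := by rw [← Real.exp_add]; ring_nf

/-- `L¹` bound for the derivative through Cauchy-Schwarz with the weight `|1 - z|²`. -/
lemma exists_integral_norm_deriv_le {g : ℕ → ℝ} {h : ℝ → ℝ} (hg : ∀ n, 0 ≤ g n) {B : ℝ} {K : ℕ}
    (hB : ∀ n : ℕ, g n ≤ B * ((n : ℝ) + 1) ^ K) (hh0 : ∀ t, 0 ≤ t → t < 1 → 0 < h t) {C : ℝ}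
    {K' : ℕ} (hd : ∀ (n : ℕ) (t : ℝ), 0 ≤ t → t < 1 →
      |((n : ℝ) + 1) * g (n + 1) - n * g n| ≤ C * (1 + n * (1 - t)) ^ K' * h t) :
    ∃ D : ℝ, 0 < D ∧ ∀ t : ℝ, 0 ≤ t → t < 1 →
      ∫ θ in (0 : ℝ)..2 * π, ‖∑' n : ℕ, (((n : ℝ) + 1) * g (n + 1) : ℝ) *
        ((t : ℂ) * Complex.exp (θ * Complex.I)) ^ n‖ ≤ D * (h t / (1 - t)) := by
  obtain ⟨E, hE, hbd⟩ := exists_one_add_pow_mul_pow_le (2 * K')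
  refine ⟨2 * π * ((1 + C ^ 2 * E) / 2), by positivity, fun t ht ht1 => ?_⟩
  have hht := hh0 t ht ht1
  have ht' : 0 < 1 - t := by linarith
  have hgeo := hasSum_geometric_of_lt_one ht ht1
  have hs := summable_succ_mul_coeff_succ_mul_pow hg hB ht ht1
  obtain ⟨d, hdn⟩ : ∃ d : ℕ → ℝ, d = fun n : ℕ => ((n : ℝ) + 1) * g (n + 1) - n * g n :=
    ⟨_, rfl⟩
  -- Of the two factors `t^n` in the square, one absorbs the polynomial and the other is kept for
  -- the geometric series.
  have hdabs : ∀ n, (d n * t ^ n) ^ 2 ≤ C ^ 2 * h t ^ 2 * E * t ^ n := fun n => by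
    have h1 : (d n) ^ 2 ≤ (C * (1 + n * (1 - t)) ^ K' * h t) ^ 2 := by
      rw [hdn]
      exact sq_le_sq' (abs_le.1 (hd n t ht ht1)).1 (abs_le.1 (hd n t ht ht1)).2
    calc (d n * t ^ n) ^ 2 = d n ^ 2 * (t ^ n * t ^ n) := by ring
      _ ≤ (C * (1 + n * (1 - t)) ^ K' * h t) ^ 2 * (t ^ n * t ^ n) :=
          mul_le_mul_of_nonneg_right h1 (by positivity)
      _ = C ^ 2 * h t ^ 2 * ((1 + n * (1 - t)) ^ (2 * K') * t ^ n) * t ^ n := by ring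
      _ ≤ C ^ 2 * h t ^ 2 * E * t ^ n := by
          have := hbd n t ht ht1
          gcongr
  have hds : Summable fun n => ‖(((d n * t ^ n : ℝ)) : ℂ)‖ := by
    have h0 : Summable fun n : ℕ => ‖((n : ℝ) * g n) * t ^ n‖ := by
      have : Summable fun n : ℕ => (n : ℝ) * g n * t ^ n := by
        refine (summable_nat_add_iff 1).1 ((hs.mul_left t).congr fun n => ?_)
        push_cast
        ring
      exact this.norm
    refine (hs.norm.add h0).of_nonneg_of_le (fun n => norm_nonneg _) (fun n => ?_)
    rw [Complex.norm_real, hdn]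
    simp only [sub_mul]
    exact norm_sub_le _ _
  have hts : Summable fun n => ‖(((t ^ n : ℝ)) : ℂ)‖ := by
    simpa [abs_of_nonneg ht] using hgeo.summable
  have hP1 := hasSum_parseval hts
  have hP2 := hasSum_parseval hds
  have hcs : Summable fun n : ℕ => ‖(((((n : ℝ) + 1) * g (n + 1)) * t ^ n : ℝ) : ℂ)‖ := by
    simp_rw [Complex.norm_real]
    exact hs.norm
  have hcont1 := continuous_fourier hts
  have hcont2 := continuous_fourier hds
  have hcont3 := continuous_fourier hcs
  -- Cauchy-Schwarz in the form `2uv ≤ h u² + v²/h`, with `u = |1-z|⁻¹` and `v = |(1-z)G'|`. The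
  -- weight `h t` balances the mean squares, of sizes `1/(1-t)` and `h(t)²/(1-t)`.
  have hpt : ∀ θ : ℝ, ‖∑' n : ℕ, (((n : ℝ) + 1) * g (n + 1) : ℝ) *
        ((t : ℂ) * Complex.exp (θ * Complex.I)) ^ n‖ ≤
      h t / 2 * ‖∑' n, ((t ^ n : ℝ) : ℂ) * Complex.exp (θ * Complex.I) ^ n‖ ^ 2 +
      (h t)⁻¹ / 2 * ‖∑' n, ((d n * t ^ n : ℝ) : ℂ) * Complex.exp (θ * Complex.I) ^ n‖ ^ 2 := by
    intro θ
    obtain ⟨z, hz⟩ : ∃ z : ℂ, z = t * Complex.exp (θ * Complex.I) := ⟨_, rfl⟩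
    have hzn : ‖z‖ = t := by
      rw [hz, norm_mul, Complex.norm_exp_ofReal_mul_I, Complex.norm_real, Real.norm_eq_abs,
        abs_of_nonneg ht, mul_one]
    have hz1 : (1 - z) ≠ 0 := by
      intro h0
      rw [sub_eq_zero] at h0
      rw [← h0, norm_one] at hzn
      linarith
    have e1 : ∑' n, ((t ^ n : ℝ) : ℂ) * Complex.exp (θ * Complex.I) ^ n = (1 - z)⁻¹ := by
      rw [← tsum_geometric_of_norm_lt_one (by rw [hzn]; exact ht1)]
      refine tsum_congr fun n => ?_
      rw [hz, mul_pow]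
      push_cast
      rfl
    have hsz : Summable fun n : ℕ => (((n : ℝ) + 1) * g (n + 1) : ℝ) * z ^ n := by
      refine summable_mul_pow_of_norm_le (t := t) ?_ hzn.le
      refine hs.congr (fun n => ?_)
      rw [Complex.norm_real, Real.norm_of_nonneg (mul_nonneg (by positivity) (hg _))]
    have e2 : ∑' n, ((d n * t ^ n : ℝ) : ℂ) * Complex.exp (θ * Complex.I) ^ n =
        (1 - z) * ∑' n : ℕ, (((n : ℝ) + 1) * g (n + 1) : ℝ) * z ^ n := by
      rw [one_sub_mul_tsum hsz]
      refine tsum_congr fun n => ?_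
      rw [hz, mul_pow, hdn]
      push_cast
      ring
    rw [e1, e2, ← hz]
    obtain ⟨S, hS⟩ : ∃ S, S = ∑' n : ℕ, (((n : ℝ) + 1) * g (n + 1) : ℝ) * z ^ n := ⟨_, rfl⟩
    rw [← hS, norm_mul, norm_inv]
    have hq : 0 < ‖1 - z‖ := norm_pos_iff.2 hz1
    have : h t / 2 * ‖1 - z‖⁻¹ ^ 2 + (h t)⁻¹ / 2 * (‖1 - z‖ * ‖S‖) ^ 2 - ‖S‖ =
        (h t)⁻¹ / 2 * (h t * ‖1 - z‖⁻¹ - ‖1 - z‖ * ‖S‖) ^ 2 := by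
      field_simp
      ring
    have h3 : 0 ≤ (h t)⁻¹ / 2 * (h t * ‖1 - z‖⁻¹ - ‖1 - z‖ * ‖S‖) ^ 2 := by positivity
    linarith
  have hint : ∫ θ in (0 : ℝ)..2 * π, ‖∑' n : ℕ, (((n : ℝ) + 1) * g (n + 1) : ℝ) *
        ((t : ℂ) * Complex.exp (θ * Complex.I)) ^ n‖ ≤
      h t / 2 * (∫ θ in (0 : ℝ)..2 * π,
        ‖∑' n, ((t ^ n : ℝ) : ℂ) * Complex.exp (θ * Complex.I) ^ n‖ ^ 2) +
      (h t)⁻¹ / 2 * ∫ θ in (0 : ℝ)..2 * π,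
        ‖∑' n, ((d n * t ^ n : ℝ) : ℂ) * Complex.exp (θ * Complex.I) ^ n‖ ^ 2 := by
    rw [← intervalIntegral.integral_const_mul, ← intervalIntegral.integral_const_mul,
      ← intervalIntegral.integral_add (Continuous.intervalIntegrable (by fun_prop) _ _)
        (Continuous.intervalIntegrable (by fun_prop) _ _)]
    refine intervalIntegral.integral_mono_on Real.two_pi_pos.le ?_
      (Continuous.intervalIntegrable (by fun_prop) _ _) (fun θ _ => hpt θ)
    refine Continuous.intervalIntegrable (hcont3.norm.congr fun θ => ?_) _ _
    congr 1
    refine tsum_congr fun n => ?_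
    push_cast
    ring
  have hI1 : ∫ θ in (0 : ℝ)..2 * π,
      ‖∑' n, ((t ^ n : ℝ) : ℂ) * Complex.exp (θ * Complex.I) ^ n‖ ^ 2 ≤ 2 * π * (1 - t)⁻¹ := by
    have h1 := hP1.tsum_eq
    have h2 : ∑' n, ‖((t ^ n : ℝ) : ℂ)‖ ^ 2 ≤ (1 - t)⁻¹ := by
      rw [← hgeo.tsum_eq]
      refine hP1.summable.tsum_le_tsum (fun n => ?_) hgeo.summable
      rw [Complex.norm_real, Real.norm_of_nonneg (by positivity)]
      exact pow_le_of_le_one (by positivity) (pow_le_one₀ ht ht1.le) two_ne_zero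
    rw [h1, inv_mul_le_iff₀ Real.two_pi_pos] at h2
    exact h2
  have hI2 : ∫ θ in (0 : ℝ)..2 * π,
      ‖∑' n, ((d n * t ^ n : ℝ) : ℂ) * Complex.exp (θ * Complex.I) ^ n‖ ^ 2 ≤
      2 * π * (C ^ 2 * h t ^ 2 * E * (1 - t)⁻¹) := by
    have h1 := hP2.tsum_eq
    have h2 : ∑' n, ‖((d n * t ^ n : ℝ) : ℂ)‖ ^ 2 ≤ C ^ 2 * h t ^ 2 * E * (1 - t)⁻¹ := by
      rw [← hgeo.tsum_eq, ← tsum_mul_left]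
      refine hP2.summable.tsum_le_tsum (fun n => ?_) (hgeo.summable.mul_left _)
      rw [Complex.norm_real, Real.norm_eq_abs, sq_abs]
      exact hdabs n
    rw [h1, inv_mul_le_iff₀ Real.two_pi_pos] at h2
    exact h2
  calc _ ≤ h t / 2 * (2 * π * (1 - t)⁻¹) +
        (h t)⁻¹ / 2 * (2 * π * (C ^ 2 * h t ^ 2 * E * (1 - t)⁻¹)) := by
        refine hint.trans ?_
        gcongr
    _ = _ := by
        field_simp

/-- Upper bound for the integral mean by the integral means of the derivative. -/
lemma exists_seriesMean_le {g : ℕ → ℝ} {h : ℝ → ℝ} (hg : ∀ n, 0 ≤ g n) {B : ℝ} {K : ℕ}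
    (hB : ∀ n : ℕ, g n ≤ B * ((n : ℝ) + 1) ^ K) (hh : ContinuousOn h (Ico 0 1))
    (hh0 : ∀ t, 0 ≤ t → t < 1 → 0 < h t) {C : ℝ}
    {K' : ℕ} (hd : ∀ (n : ℕ) (t : ℝ), 0 ≤ t → t < 1 →
      |((n : ℝ) + 1) * g (n + 1) - n * g n| ≤ C * (1 + n * (1 - t)) ^ K' * h t) :
    ∃ D : ℝ, 0 < D ∧ ∀ ρ : ℝ, 0 ≤ ρ → ρ < 1 →
      seriesMean g ρ ≤ g 0 + D * ∫ t in (0 : ℝ)..ρ, h t / (1 - t) := by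
  obtain ⟨D, hD, hderiv⟩ := exists_integral_norm_deriv_le hg hB hh0 hd
  refine ⟨(2 * π)⁻¹ * D, by positivity, fun ρ hρ hρ1 => ?_⟩
  obtain ⟨c, hc⟩ : ∃ c : ℕ → ℂ, c = fun n : ℕ => ((((n : ℝ) + 1) * g (n + 1) : ℝ) : ℂ) :=
    ⟨_, rfl⟩
  have hcs : Summable fun n => ‖c n‖ * ρ ^ n := by
    refine (summable_succ_mul_coeff_succ_mul_pow hg hB hρ hρ1).congr (fun n => ?_)
    rw [hc, Complex.norm_real, Real.norm_of_nonneg (mul_nonneg (by positivity) (hg _))]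
  -- a globally continuous extension of the derivative
  obtain ⟨Φ, hΦ⟩ : ∃ Φ : ℝ → ℝ → ℂ, Φ = fun t θ : ℝ =>
      ∑' n, c n * (((max 0 (min t ρ) : ℝ) : ℂ) * Complex.exp (θ * Complex.I)) ^ n := ⟨_, rfl⟩
  have hΦc : Continuous (Function.uncurry Φ) := by
    rw [hΦ]
    refine continuous_tsum (u := fun n => ‖c n‖ * ρ ^ n) (fun n => ?_) hcs (fun n p => ?_)
    · have := continuous_exp_mul_I.comp continuous_snd (X := ℝ × ℝ)
      have h2 : Continuous fun p : ℝ × ℝ => ((max 0 (min p.1 ρ) : ℝ) : ℂ) := by fun_prop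
      exact ((h2.mul this).pow n).const_mul (c n)
    · rw [norm_mul, norm_pow, norm_mul, Complex.norm_exp_ofReal_mul_I, mul_one,
        Complex.norm_real, Real.norm_of_nonneg (le_max_left _ _)]
      gcongr
      exact max_le hρ (min_le_right _ _)
  have hΦeq : ∀ t ∈ Icc 0 ρ, ∀ θ : ℝ,
      Φ t θ = ∑' n, c n * ((t : ℂ) * Complex.exp (θ * Complex.I)) ^ n := fun t ht θ => by
    rw [hΦ]
    simp only
    rw [min_eq_left ht.2, max_eq_right ht.1]
  -- The fundamental theorem of calculus along a radius, carried out termwise: `(n+1) g (n+1) t^n`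
  -- integrates to `g (n+1) ρ^(n+1)`.
  have hpt : ∀ θ : ℝ, ‖∑' n, (g n : ℂ) * (ρ * Complex.exp (θ * Complex.I)) ^ n‖ ≤
      g 0 + ∫ t in (0 : ℝ)..ρ, ‖Φ t θ‖ := fun θ => by
    have hw := Complex.norm_exp_ofReal_mul_I θ
    have h1 := (hasSum_integral_powerSeries hρ hcs hw.le).tsum_eq
    have hsum : Summable fun n => (g n : ℂ) * (ρ * Complex.exp (θ * Complex.I)) ^ n := by
      refine summable_mul_pow_of_norm_le (t := ρ) ?_ (by
        rw [norm_mul, hw, mul_one, Complex.norm_real, Real.norm_of_nonneg hρ])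
      refine (summable_coeff_mul_pow hg hB hρ hρ1).congr (fun n => ?_)
      rw [Complex.norm_real, Real.norm_of_nonneg (hg _)]
    have h2 : ∑' n, (g (n + 1) : ℂ) * (ρ * Complex.exp (θ * Complex.I)) ^ (n + 1) =
        Complex.exp (θ * Complex.I) *
          ∫ t in (0 : ℝ)..ρ, ∑' n, c n * (t * Complex.exp (θ * Complex.I)) ^ n := by
      rw [← h1, ← tsum_mul_left]
      refine tsum_congr fun n => ?_
      rw [hc]
      have : (n : ℂ) + 1 ≠ 0 := by exact_mod_cast n.succ_ne_zero
      push_cast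
      field_simp
      ring
    rw [hsum.tsum_eq_zero_add, h2]
    refine (norm_add_le _ _).trans ?_
    rw [pow_zero, mul_one, Complex.norm_real, Real.norm_of_nonneg (hg 0), norm_mul, hw, one_mul]
    gcongr
    refine (intervalIntegral.norm_integral_le_integral_norm hρ).trans (le_of_eq ?_)
    refine intervalIntegral.integral_congr fun t ht => ?_
    rw [uIcc_of_le hρ] at ht
    rw [hΦeq t ht θ]
  have hΦn : Continuous fun p : ℝ × ℝ => ‖Φ p.1 p.2‖ := hΦc.norm
  have hin : Continuous fun θ : ℝ => ∫ t in (0 : ℝ)..ρ, ‖Φ t θ‖ :=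
    intervalIntegral.continuous_parametric_intervalIntegral_of_continuous'
      (f := fun θ t => ‖Φ t θ‖) (hΦn.comp continuous_swap) 0 ρ
  have hin' : Continuous fun t : ℝ => ∫ θ in (0 : ℝ)..2 * π, ‖Φ t θ‖ :=
    intervalIntegral.continuous_parametric_intervalIntegral_of_continuous'
      (f := fun t θ => ‖Φ t θ‖) hΦn 0 (2 * π)
  have hswap : ∫ θ in (0 : ℝ)..2 * π, ∫ t in (0 : ℝ)..ρ, ‖Φ t θ‖ =
      ∫ t in (0 : ℝ)..ρ, ∫ θ in (0 : ℝ)..2 * π, ‖Φ t θ‖ := by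
    refine intervalIntegral_intervalIntegral_swap (F := fun θ t => ‖Φ t θ‖) ?_
    have h1 : IntegrableOn (Function.uncurry fun θ t => ‖Φ t θ‖)
        (uIcc 0 (2 * π) ×ˢ uIcc 0 ρ) :=
      (hΦn.comp continuous_swap).continuousOn.integrableOn_compact
        (isCompact_uIcc.prod isCompact_uIcc)
    exact h1.mono_set (prod_mono uIoc_subset_uIcc uIoc_subset_uIcc)
  have hGc : Continuous fun θ : ℝ =>
      ‖∑' n, (g n : ℂ) * (ρ * Complex.exp (θ * Complex.I)) ^ n‖ := by
    have h1 : Summable fun n => ‖((g n * ρ ^ n : ℝ) : ℂ)‖ := by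
      simp_rw [Complex.norm_real]
      exact (summable_coeff_mul_pow hg hB hρ hρ1).norm
    refine (continuous_fourier h1).norm.congr fun θ => ?_
    congr 1
    refine tsum_congr fun n => ?_
    push_cast
    ring
  have hfin : ∫ θ in (0 : ℝ)..2 * π, ‖∑' n, (g n : ℂ) * (ρ * Complex.exp (θ * Complex.I)) ^ n‖ ≤
      2 * π * g 0 + D * ∫ t in (0 : ℝ)..ρ, h t / (1 - t) := by
    calc _ ≤ ∫ θ in (0 : ℝ)..2 * π, (g 0 + ∫ t in (0 : ℝ)..ρ, ‖Φ t θ‖) :=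
          intervalIntegral.integral_mono_on Real.two_pi_pos.le (hGc.intervalIntegrable _ _)
            ((continuous_const.add hin).intervalIntegrable _ _) (fun θ _ => hpt θ)
      _ = 2 * π * g 0 + ∫ t in (0 : ℝ)..ρ, ∫ θ in (0 : ℝ)..2 * π, ‖Φ t θ‖ := by
          rw [intervalIntegral.integral_add intervalIntegrable_const
            (hin.intervalIntegrable _ _), hswap, intervalIntegral.integral_const]
          simp
      _ ≤ _ := by
          rw [← intervalIntegral.integral_const_mul]
          refine add_le_add_right (intervalIntegral.integral_mono_on hρ
            (hin'.intervalIntegrable _ _) ?_ (fun t ht => ?_)) _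
          · exact ((continuousOn_div_one_sub hh hρ1).const_mul _).intervalIntegrable_of_Icc hρ
          · simp_rw [hΦeq t ht, hc]
            exact hderiv t ht.1 (ht.2.trans_lt hρ1)
  calc seriesMean g ρ ≤ (2 * π)⁻¹ * (2 * π * g 0 + D * ∫ t in (0 : ℝ)..ρ, h t / (1 - t)) :=
        mul_le_mul_of_nonneg_left hfin (by positivity)
    _ = _ := by
        field_simp

/-! ### Integration in polar coordinates over the disc -/

/-- Fubini in polar coordinates needs integrability, not just the value of the integral; it comes
from the change of variables with Jacobian `r`. -/
lemma integrableOn_comp_polarCoord_symm {F : ℂ → ℂ} (hF : Integrable F) :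
    IntegrableOn (fun p : ℝ × ℝ => p.1 • F (Complex.polarCoord.symm p)) polarCoord.target := by
  have h1 : Integrable (fun p : ℝ × ℝ => F (Complex.measurableEquivRealProd.symm p)) :=
    (Complex.volume_preserving_equiv_real_prod.symm).integrable_comp_emb
      Complex.measurableEquivRealProd.symm.measurableEmbedding |>.2 hF
  have h2 := (integrableOn_image_iff_integrableOn_abs_det_fderiv_smul volume
    polarCoord.open_target.measurableSet
    (fun p _ => (hasFDerivAt_polarCoord_symm p).hasFDerivWithinAt)
    polarCoord.symm.injOn (fun p : ℝ × ℝ => F (Complex.measurableEquivRealProd.symm p))).1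
    h1.integrableOn
  refine h2.congr_fun (fun p hp => ?_) polarCoord.open_target.measurableSet
  simp only [det_fderivPolarCoordSymm]
  rw [abs_of_pos hp.1, Complex.measurableEquivRealProd_symm_polarCoord_symm_apply]

lemma integrable_discArea_iff {F : ℂ → ℂ} :
    Integrable F discArea ↔ IntegrableOn F (Metric.ball 0 1) := by
  rw [discArea, integrable_smul_measure (by simp [Real.pi_pos]) ENNReal.ofReal_ne_top,
    IntegrableOn]

lemma integral_discArea_eq_polar {F : ℂ → ℂ} (hF : Integrable F discArea) :
    ∫ z, F z ∂discArea = (π : ℂ)⁻¹ * ∫ r in (0 : ℝ)..1, (r : ℂ) *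
      ∫ θ in (0 : ℝ)..2 * π, F (r * Complex.exp (θ * Complex.I)) := by
  have hF' := integrable_discArea_iff.1 hF
  rw [← integrable_indicator_iff Metric.isOpen_ball.measurableSet] at hF'
  have h1 := integrableOn_comp_polarCoord_symm hF'
  have h2 : ∀ p ∈ polarCoord.target,
      p.1 • (Metric.ball (0 : ℂ) 1).indicator F (Complex.polarCoord.symm p) =
      (Ioo (0 : ℝ) 1 ×ˢ Ioo (-π) π).indicator
        (fun p : ℝ × ℝ => (p.1 : ℂ) * F (p.1 * Complex.exp (p.2 * Complex.I))) p := by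
    rintro ⟨r, θ⟩ ⟨hr, hθ⟩
    have hr0 : (0 : ℝ) < r := hr
    have hsymm : Complex.polarCoord.symm (r, θ) = r * Complex.exp (θ * Complex.I) := by
      rw [Complex.polarCoord_symm_apply, Complex.exp_mul_I, Complex.ofReal_cos, Complex.ofReal_sin]
    by_cases hr1 : r < 1
    · rw [indicator_of_mem, indicator_of_mem, hsymm, Complex.real_smul]
      · exact ⟨⟨hr0, hr1⟩, hθ⟩
      · rw [mem_ball_zero_iff, Complex.norm_polarCoord_symm, abs_of_pos hr0]
        exact hr1
    · rw [indicator_of_notMem, indicator_of_notMem, smul_zero]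
      · exact fun h => hr1 h.1.2
      · rw [mem_ball_zero_iff, Complex.norm_polarCoord_symm, abs_of_pos hr0]
        exact hr1
  have hms : MeasurableSet (Ioo (0 : ℝ) 1 ×ˢ Ioo (-π) π) := measurableSet_Ioo.prod measurableSet_Ioo
  have hsub : Ioo (0 : ℝ) 1 ×ˢ Ioo (-π) π ⊆ polarCoord.target := by
    rw [polarCoord_target]
    exact prod_mono (fun r hr => hr.1) subset_rfl
  have hmt := polarCoord.open_target.measurableSet
  have h3 : IntegrableOn (fun p : ℝ × ℝ => (p.1 : ℂ) * F (p.1 * Complex.exp (p.2 * Complex.I)))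
      (Ioo (0 : ℝ) 1 ×ˢ Ioo (-π) π) := by
    have := (h1.congr_fun h2 hmt).mono_set hsub
    exact this.congr_fun (fun p hp => indicator_of_mem hp _) hms
  have h4 : ∫ z in Metric.ball (0 : ℂ) 1, F z =
      ∫ p in Ioo (0 : ℝ) 1 ×ˢ Ioo (-π) π, (p.1 : ℂ) * F (p.1 * Complex.exp (p.2 * Complex.I)) := by
    rw [← integral_indicator Metric.isOpen_ball.measurableSet,
      ← Complex.integral_comp_polarCoord_symm, setIntegral_congr_fun hmt h2,
      setIntegral_indicator hms, inter_eq_right.2 hsub]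
  rw [discArea, integral_smul_measure, ENNReal.toReal_ofReal (by positivity), h4,
    Measure.volume_eq_prod, setIntegral_prod _ h3, Complex.real_smul, Complex.ofReal_inv,
    intervalIntegral.integral_of_le zero_le_one, integral_Ioc_eq_integral_Ioo]
  congr 1
  refine setIntegral_congr_fun measurableSet_Ioo (fun r _ => ?_)
  simp only
  rw [integral_const_mul]
  congr 1
  have hper : Function.Periodic (fun θ : ℝ => F (r * Complex.exp (θ * Complex.I))) (2 * π) :=
    fun θ => by
      simp only
      congr 2
      push_cast
      rw [add_mul, Complex.exp_add, Complex.exp_two_pi_mul_I, mul_one]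
  have h5 := hper.intervalIntegral_add_eq (-π) 0
  rw [zero_add, show -π + 2 * π = π by ring] at h5
  rw [← h5, intervalIntegral.integral_of_le (by linarith [Real.pi_pos]),
    integral_Ioc_eq_integral_Ioo]

/-! ### Taylor coefficients -/

lemma hasSum_taylorCoeff {f : ℂ → ℂ} (hf : DifferentiableOn ℂ f (Metric.ball 0 1)) {z : ℂ}
    (hz : ‖z‖ < 1) : HasSum (fun n => taylorCoeff f n * z ^ n) (f z) := by
  refine (Complex.hasSum_taylorSeries_on_ball hf (mem_ball_zero_iff.2 hz)).congr_fun fun n => ?_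
  rw [taylorCoeff, sub_zero, smul_eq_mul, smul_eq_mul]
  ring

lemma summable_norm_taylorCoeff {f : ℂ → ℂ} (hf : DifferentiableOn ℂ f (Metric.ball 0 1)) {r : ℝ}
    (hr : 0 ≤ r) (hr1 : r < 1) : Summable fun n => ‖taylorCoeff f n * (r : ℂ) ^ n‖ :=
  (hasSum_taylorCoeff hf (z := r)
    (by rwa [Complex.norm_real, Real.norm_of_nonneg hr])).summable.norm

lemma integral_circle_mul_conj_pow {f : ℂ → ℂ} (hf : DifferentiableOn ℂ f (Metric.ball 0 1))
    {r : ℝ} (hr : 0 ≤ r) (hr1 : r < 1) (n : ℕ) :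
    ∫ θ in (0 : ℝ)..2 * π, f (r * Complex.exp (θ * Complex.I)) *
      conj ((r : ℂ) * Complex.exp (θ * Complex.I)) ^ n =
      2 * π * taylorCoeff f n * (r : ℂ) ^ (2 * n) := by
  have h := integral_conj_exp_pow_mul_fourier (summable_norm_taylorCoeff hf hr hr1) n
  have h1 : ∀ θ : ℝ, f (r * Complex.exp (θ * Complex.I)) *
      conj ((r : ℂ) * Complex.exp (θ * Complex.I)) ^ n = (r : ℂ) ^ n *
      (conj (Complex.exp (θ * Complex.I)) ^ n *
      ∑' k, (taylorCoeff f k * (r : ℂ) ^ k) * Complex.exp (θ * Complex.I) ^ k) := fun θ => by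
    have h2 := (hasSum_taylorCoeff hf (z := r * Complex.exp (θ * Complex.I)) (by
      rwa [norm_mul, Complex.norm_exp_ofReal_mul_I, mul_one, Complex.norm_real,
        Real.norm_of_nonneg hr])).tsum_eq
    simp_rw [mul_pow, ← mul_assoc] at h2
    rw [h2, map_mul, Complex.conj_ofReal, mul_pow]
    ring
  simp_rw [h1]
  rw [intervalIntegral.integral_const_mul, h]
  ring

/-! ### The weighted Bergman space -/

lemma IsRadialWeight.integrable_discArea {ω : ℝ → ℝ} (h : IsRadialWeight ω) :
    Integrable (fun z : ℂ => ω ‖z‖) discArea := by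
  refine Integrable.smul_measure ?_ ENNReal.ofReal_ne_top
  refine (integrableOn_fun_norm_addHaar (volume : Measure ℂ) (f := ω)).2 ?_
  rw [Complex.finrank_real_complex]
  have h1 := (h.intervalIntegrable_pow_mul 1 le_rfl zero_le_one le_rfl)
  rw [intervalIntegrable_iff_integrableOn_Ioo_of_le zero_le_one] at h1
  exact h1

lemma ae_discArea_norm_lt_one : ∀ᵐ z ∂discArea, ‖z‖ < 1 := by
  refine Measure.ae_smul_measure ?_ _
  filter_upwards [ae_restrict_mem Metric.isOpen_ball.measurableSet] with z hz
  exact mem_ball_zero_iff.1 hz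

lemma aestronglyMeasurable_discArea {f : ℂ → ℂ} (hf : ContinuousOn f (Metric.ball 0 1)) :
    AEStronglyMeasurable f discArea :=
  (hf.aestronglyMeasurable Metric.isOpen_ball.measurableSet).smul_measure _

/-- Functions in `A²_ω` are integrable with respect to `ω dA`. -/
lemma MemBergmanTwo.integrable_mul {ω : ℝ → ℝ} (h : IsRadialWeight ω) {f : ℂ → ℂ}
    (hf : MemBergmanTwo ω f) : Integrable (fun z => f z * (ω ‖z‖ : ℂ)) discArea := by
  -- Domination by `|f| ≤ |f|² + 1`, as `ω dA` is a finite measure.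
  refine (hf.integrable.add h.integrable_discArea).mono'
    ((aestronglyMeasurable_discArea hf.differentiableOn.continuousOn).mul
      (Complex.continuous_ofReal.comp_aestronglyMeasurable h.integrable_discArea.1)) ?_
  filter_upwards [ae_discArea_norm_lt_one] with z hz
  have h0 := h.nonneg ‖z‖ ⟨norm_nonneg z, hz⟩
  rw [norm_mul, Complex.norm_real, Real.norm_of_nonneg h0]
  simp only [Pi.add_apply]
  nlinarith [mul_nonneg h0 (sq_nonneg (‖f z‖ - 1)), mul_nonneg h0 (sq_nonneg ‖f z‖)]

lemma norm_le_mul_conj_pow {z : ℂ} (hz : ‖z‖ < 1) (w : ℂ) (n : ℕ) :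
    ‖w * conj z ^ n‖ ≤ ‖w‖ := by
  rw [norm_mul, norm_pow, RCLike.norm_conj]
  exact mul_le_of_le_one_right (norm_nonneg _) (pow_le_one₀ (norm_nonneg _) hz.le)

lemma MemBergmanTwo.integrable_mul_conj_pow {ω : ℝ → ℝ} (h : IsRadialWeight ω) {f : ℂ → ℂ}
    (hf : MemBergmanTwo ω f) (n : ℕ) :
    Integrable (fun z => f z * (ω ‖z‖ : ℂ) * conj z ^ n) discArea := by
  have h1 := hf.integrable_mul h
  refine h1.mono (h1.1.mul (Complex.continuous_conj.pow n).aestronglyMeasurable) ?_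
  filter_upwards [ae_discArea_norm_lt_one] with z hz
  exact norm_le_mul_conj_pow hz _ n

/-- Integration against a conjugate monomial extracts a Taylor coefficient. -/
lemma MemBergmanTwo.integral_mul_conj_pow {ω : ℝ → ℝ} (h : IsRadialWeight ω) {f : ℂ → ℂ}
    (hf : MemBergmanTwo ω f) (n : ℕ) :
    ∫ z, f z * (ω ‖z‖ : ℂ) * conj z ^ n ∂discArea =
      2 * moment ω (2 * n + 1) * taylorCoeff f n := by
  rw [integral_discArea_eq_polar (hf.integrable_mul_conj_pow h n)]
  have h1 : ∫ r in (0 : ℝ)..1, (r : ℂ) * ∫ θ in (0 : ℝ)..2 * π,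
      f (r * Complex.exp (θ * Complex.I)) * (ω ‖(r : ℂ) * Complex.exp (θ * Complex.I)‖ : ℂ) *
        conj ((r : ℂ) * Complex.exp (θ * Complex.I)) ^ n =
      ∫ r in (0 : ℝ)..1, (2 * π * taylorCoeff f n) * ((r ^ (2 * n + 1) * ω r : ℝ) : ℂ) := by
    rw [intervalIntegral.integral_of_le zero_le_one, intervalIntegral.integral_of_le zero_le_one,
      integral_Ioc_eq_integral_Ioo, integral_Ioc_eq_integral_Ioo]
    refine setIntegral_congr_fun measurableSet_Ioo fun r hr => ?_
    have h2 : ∀ θ : ℝ, f (r * Complex.exp (θ * Complex.I)) *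
        (ω ‖(r : ℂ) * Complex.exp (θ * Complex.I)‖ : ℂ) *
        conj ((r : ℂ) * Complex.exp (θ * Complex.I)) ^ n =
        (ω r : ℂ) * (f (r * Complex.exp (θ * Complex.I)) *
          conj ((r : ℂ) * Complex.exp (θ * Complex.I)) ^ n) := fun θ => by
      rw [norm_mul, Complex.norm_exp_ofReal_mul_I, mul_one, Complex.norm_real,
        Real.norm_of_nonneg hr.1.le]
      ring
    simp only [h2]
    rw [intervalIntegral.integral_const_mul,
      integral_circle_mul_conj_pow hf.differentiableOn hr.1.le hr.2]
    push_cast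
    ring
  rw [h1, intervalIntegral.integral_const_mul, intervalIntegral.integral_ofReal, moment]
  have : (π : ℂ) ≠ 0 := by exact_mod_cast Real.pi_ne_zero
  field_simp

lemma memBergmanTwo_of_bounded {ω : ℝ → ℝ} (h : IsRadialWeight ω) {f : ℂ → ℂ}
    (hf : DifferentiableOn ℂ f (Metric.ball 0 1)) {M : ℝ} (hM : ∀ z, ‖z‖ < 1 → ‖f z‖ ≤ M) :
    MemBergmanTwo ω f where
  differentiableOn := hf
  integrable := by
    refine h.integrable_discArea.bdd_mul
      ((aestronglyMeasurable_discArea hf.continuousOn).norm.pow 2) (c := M ^ 2) ?_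
    filter_upwards [ae_discArea_norm_lt_one] with z hz
    rw [Real.norm_of_nonneg (by positivity)]
    exact pow_le_pow_left₀ (norm_nonneg _) (hM z hz) 2

lemma memBergmanTwo_pow {ω : ℝ → ℝ} (h : IsRadialWeight ω) (n : ℕ) :
    MemBergmanTwo ω fun z => z ^ n :=
  memBergmanTwo_of_bounded h (differentiable_pow n).differentiableOn (M := 1) fun z hz => by
    rw [norm_pow]
    exact pow_le_one₀ (norm_nonneg _) hz.le

/-- The Taylor coefficients of a reproducing kernel. -/
lemma IsReproducingKernelAt.taylorCoeff_eq {ω : ℝ → ℝ} (h : IsRadialWeight ω) {a : ℂ}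
    {B : ℂ → ℂ} (hB : IsReproducingKernelAt ω a B) (n : ℕ) :
    taylorCoeff B n = conj a ^ n / (2 * moment ω (2 * n + 1)) := by
  have h1 := congrArg conj (hB.reproducing _ (memBergmanTwo_pow h n))
  rw [← integral_conj] at h1
  have h2 := hB.mem.integral_mul_conj_pow h n
  have h3 : ∀ z : ℂ, conj (z ^ n * conj (B z) * (ω ‖z‖ : ℂ)) =
      B z * (ω ‖z‖ : ℂ) * conj z ^ n := fun z => by
    simp only [map_mul, map_pow, Complex.conj_conj, Complex.conj_ofReal]
    ring
  simp_rw [h3] at h1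
  rw [h2, map_pow] at h1
  have hm : (moment ω (2 * n + 1) : ℂ) ≠ 0 := by exact_mod_cast (h.moment_pos _).ne'
  rw [h1]
  field_simp

/-- Moments are at least `s^(2n+1) ω̂(s)` for any `s < 1`. The midpoint `s = (1+‖a‖)/2` satisfies
`‖a‖ < s²`, leaving a geometric series of ratio `‖a‖/s²`. -/
lemma IsRadialWeight.summable_kernelCoeff {ω : ℝ → ℝ} (h : IsRadialWeight ω) {a : ℂ}
    (ha : ‖a‖ < 1) : Summable fun n : ℕ => ‖conj a ^ n / (2 * moment ω (2 * n + 1) : ℂ)‖ := by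
  obtain ⟨s, hs⟩ : ∃ s, s = (1 + ‖a‖) / 2 := ⟨_, rfl⟩
  have ha0 := norm_nonneg a
  have hs0 : 0 < s := by linarith
  have hs1 : s < 1 := by linarith
  have hq : ‖a‖ / s ^ 2 < 1 := by
    rw [div_lt_one (by positivity), hs]
    nlinarith [sq_pos_of_pos (sub_pos.2 ha)]
  have hT := h.tail_pos s ⟨hs0.le, hs1⟩
  refine ((summable_geometric_of_lt_one (by positivity) hq).mul_left
    (2 * s * tail ω s)⁻¹).of_nonneg_of_le (fun n => norm_nonneg _) (fun n => ?_)
  have hm := h.moment_pos (2 * n + 1)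
  have h1 := h.pow_mul_tail_le_moment (2 * n + 1) hs0.le hs1.le
  rw [norm_div, norm_mul, norm_pow, RCLike.norm_conj, Complex.norm_real, Real.norm_of_nonneg hm.le,
    Complex.norm_ofNat]
  calc ‖a‖ ^ n / (2 * moment ω (2 * n + 1)) ≤ ‖a‖ ^ n / (2 * (s ^ (2 * n + 1) * tail ω s)) := by
        gcongr
    _ = _ := by
        rw [div_pow, pow_succ, pow_mul]
        field_simp

/-- Existence of the reproducing kernels of `A²_ω`. -/
lemma IsRadialWeight.exists_isReproducingKernelAt {ω : ℝ → ℝ} (h : IsRadialWeight ω) {a : ℂ}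
    (ha : ‖a‖ < 1) : ∃ B, IsReproducingKernelAt ω a B := by
  obtain ⟨b, hb⟩ : ∃ b : ℕ → ℂ, b = fun n : ℕ => conj a ^ n / (2 * moment ω (2 * n + 1) : ℂ) :=
    ⟨_, rfl⟩
  have hbs : Summable fun n => ‖b n‖ := by
    rw [hb]
    exact h.summable_kernelCoeff ha
  have hle : ∀ (n : ℕ) (z : ℂ), ‖z‖ < 1 → ‖b n * z ^ n‖ ≤ ‖b n‖ := fun n z hz => by
    rw [norm_mul, norm_pow]
    exact mul_le_of_le_one_right (norm_nonneg _) (pow_le_one₀ (norm_nonneg _) hz.le)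
  -- Absolute summability of `b` makes the candidate bounded, hence a member of `A²_ω`, and also
  -- justifies termwise integration against `f`.
  refine ⟨fun z => ∑' n, b n * z ^ n, memBergmanTwo_of_bounded h ?_ (M := ∑' n, ‖b n‖) ?_, ?_⟩
  · exact Complex.differentiableOn_tsum_of_summable_norm hbs
      (fun n => ((differentiable_pow n).const_mul _).differentiableOn) Metric.isOpen_ball
      (fun n z hz => hle n z (mem_ball_zero_iff.1 hz))
  · exact fun z hz => tsum_of_norm_bounded hbs.hasSum (fun n => hle n z hz)
  · intro f hf
    have hfi := hf.integrable_mul h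
    have h1 := hasSum_integral_of_summable_integral_norm (μ := discArea)
      (F := fun n z => conj (b n) * (f z * (ω ‖z‖ : ℂ) * conj z ^ n))
      (fun n => (hf.integrable_mul_conj_pow h n).const_mul _) (by
        refine (hbs.mul_right (∫ z, ‖f z * (ω ‖z‖ : ℂ)‖ ∂discArea)).of_nonneg_of_le
          (fun n => integral_nonneg fun z => norm_nonneg _) (fun n => ?_)
        rw [← integral_const_mul]
        refine integral_mono_ae ((hf.integrable_mul_conj_pow h n).const_mul _).norm
          (hfi.norm.const_mul _) ?_
        filter_upwards [ae_discArea_norm_lt_one] with z hz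
        rw [norm_mul, RCLike.norm_conj]
        exact mul_le_mul_of_nonneg_left (norm_le_mul_conj_pow hz _ n) (norm_nonneg _))
    simp_rw [integral_const_mul, hf.integral_mul_conj_pow h] at h1
    have h2 : ∀ n, conj (b n) * (2 * moment ω (2 * n + 1) * taylorCoeff f n) =
        taylorCoeff f n * a ^ n := fun n => by
      have hm : (moment ω (2 * n + 1) : ℂ) ≠ 0 := by exact_mod_cast (h.moment_pos _).ne'
      rw [hb]
      simp only [map_div₀, map_pow, Complex.conj_conj, map_mul, Complex.conj_ofReal, map_ofNat]
      field_simp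
    simp_rw [h2] at h1
    rw [(hasSum_taylorCoeff hf.differentiableOn ha).unique h1]
    refine integral_congr_ae (Filter.Eventually.of_forall fun z => ?_)
    simp only
    rw [Complex.conj_tsum, ← tsum_mul_left, ← tsum_mul_right]
    refine tsum_congr fun n => ?_
    simp only [map_mul, map_pow]
    ring

/-- The Taylor coefficients of the Bergman kernel of a radial weight. -/
lemma IsRadialWeight.taylorCoeff_bergmanKernel {ω : ℝ → ℝ} (h : IsRadialWeight ω) {a : ℂ}
    (ha : ‖a‖ < 1) (n : ℕ) :
    taylorCoeff (bergmanKernel ω a) n = conj a ^ n / (2 * moment ω (2 * n + 1)) := by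
  have hex := h.exists_isReproducingKernelAt ha
  rw [bergmanKernel, dif_pos hex]
  exact hex.choose_spec.taylorCoeff_eq h n

/-! ### The coefficients of `D^μ(B^ω_a)` -/

/-- The Taylor coefficients of `D^μ(B^ω_a)` as a function of `conj a * z`. -/
def kernelCoeff (ω μ : ℝ → ℝ) (n : ℕ) : ℝ :=
  1 / (2 * moment ω (2 * n + 1) * moment μ (2 * n + 1))

/-- The reciprocal of the product of the tails of two weights. -/
def invTail (ω μ : ℝ → ℝ) (t : ℝ) : ℝ := 1 / (tail ω t * tail μ t)

section Coefficients

variable {ω μ : ℝ → ℝ}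

lemma kernelCoeff_pos (hω : IsRadialWeight ω) (hμ : IsRadialWeight μ) (n : ℕ) :
    0 < kernelCoeff ω μ n := by
  have h1 := hω.moment_pos (2 * n + 1)
  have h2 := hμ.moment_pos (2 * n + 1)
  unfold kernelCoeff
  positivity

lemma kernelCoeff_mono (hω : IsRadialWeight ω) (hμ : IsRadialWeight μ) (n : ℕ) :
    kernelCoeff ω μ n ≤ kernelCoeff ω μ (n + 1) := by
  have h1 := hω.moment_pos (2 * (n + 1) + 1)
  have h2 := hμ.moment_pos (2 * (n + 1) + 1)
  have h5 := hω.moment_pos (2 * n + 1)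
  have h3 := hω.moment_anti (show 2 * n + 1 ≤ 2 * (n + 1) + 1 by omega)
  have h4 := hμ.moment_anti (show 2 * n + 1 ≤ 2 * (n + 1) + 1 by omega)
  unfold kernelCoeff
  gcongr

lemma invTail_pos (hω : IsRadialWeight ω) (hμ : IsRadialWeight μ) {t : ℝ} (ht : 0 ≤ t)
    (ht1 : t < 1) : 0 < invTail ω μ t := by
  have h1 := hω.tail_pos t ⟨ht, ht1⟩
  have h2 := hμ.tail_pos t ⟨ht, ht1⟩
  unfold invTail
  positivity

lemma continuousOn_invTail (hω : IsRadialWeight ω) (hμ : IsRadialWeight μ) :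
    ContinuousOn (invTail ω μ) (Ico 0 1) :=
  continuousOn_const.div ((hω.continuousOn_tail.mono Ico_subset_Icc_self).mul
    (hμ.continuousOn_tail.mono Ico_subset_Icc_self))
    (fun t ht => (mul_pos (hω.tail_pos t ht) (hμ.tail_pos t ht)).ne')

/-- The polynomial factor is the price of uniformity in `n` and `t`: for fixed `t` the coefficients
tend to infinity. -/
lemma exists_kernelCoeff_succ_le (hω : IsUpperDoubling ω) (hμ : IsUpperDoubling μ) :
    ∃ (C : ℝ) (K : ℕ), 0 < C ∧ ∀ (n : ℕ) (t : ℝ), 0 ≤ t → t < 1 →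
      kernelCoeff ω μ (n + 1) ≤ C * (1 + n * (1 - t)) ^ K * invTail ω μ t := by
  obtain ⟨C₁, K₁, hC₁, h₁⟩ := hω.exists_tail_le_moment
  obtain ⟨C₂, K₂, hC₂, h₂⟩ := hμ.exists_tail_le_moment
  refine ⟨C₁ * C₂, K₁ + K₂, by positivity, fun n t ht ht1 => ?_⟩
  have e1 := h₁ n t ht ht1
  have e2 := h₂ n t ht ht1
  have m1 := hω.toIsRadialWeight.moment_pos (2 * n + 3)
  have m2 := hμ.toIsRadialWeight.moment_pos (2 * n + 3)
  have t1 := hω.tail_pos t ⟨ht, ht1⟩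
  have t2 := hμ.tail_pos t ⟨ht, ht1⟩
  have hx : 0 < 1 + n * (1 - t) := by
    have : 0 ≤ n * (1 - t) := mul_nonneg n.cast_nonneg (by linarith)
    linarith
  have e3 : tail ω t * tail μ t ≤ (C₁ * (1 + n * (1 - t)) ^ K₁ * moment ω (2 * n + 3)) *
      (C₂ * (1 + n * (1 - t)) ^ K₂ * moment μ (2 * n + 3)) :=
    mul_le_mul e1 e2 t2.le (by positivity)
  rw [kernelCoeff, invTail, mul_one_div, show 2 * (n + 1) + 1 = 2 * n + 3 by ring,
    div_le_div_iff₀ (by positivity) (by positivity), one_mul]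
  have e4 : 0 ≤ C₁ * (1 + n * (1 - t)) ^ K₁ * moment ω (2 * n + 3) *
      (C₂ * (1 + n * (1 - t)) ^ K₂ * moment μ (2 * n + 3)) := by positivity
  calc tail ω t * tail μ t ≤ 2 * ((C₁ * (1 + n * (1 - t)) ^ K₁ * moment ω (2 * n + 3)) *
      (C₂ * (1 + n * (1 - t)) ^ K₂ * moment μ (2 * n + 3))) := by linarith
    _ = _ := by ring

lemma exists_kernelCoeff_le_pow (hω : IsUpperDoubling ω) (hμ : IsUpperDoubling μ) :
    ∃ (B : ℝ) (K : ℕ), ∀ n : ℕ, kernelCoeff ω μ n ≤ B * ((n : ℝ) + 1) ^ K := by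
  obtain ⟨C, K, -, h⟩ := exists_kernelCoeff_succ_le hω hμ
  refine ⟨C * invTail ω μ 0, K, fun n => ?_⟩
  have h1 := h n 0 le_rfl one_pos
  have h2 := kernelCoeff_mono hω.toIsRadialWeight hμ.toIsRadialWeight n
  calc kernelCoeff ω μ n ≤ C * (1 + n * (1 - 0)) ^ K * invTail ω μ 0 := h2.trans h1
    _ = _ := by ring

/-- Discrete product rule `ab - a'b' = (a - a')b + a'(b - b')`, divided by `2aba'b'`. -/
lemma mul_one_div_sub_one_div_le {x a a' b b' C₁ C₂ : ℝ} (ha : 0 < a) (ha' : 0 < a') (hb : 0 < b)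
    (hb' : 0 < b') (haa : a' ≤ a) (hC₂ : 0 ≤ C₂) (h₁ : x * (a - a') ≤ C₁ * a)
    (h₂ : x * (b - b') ≤ C₂ * b) :
    x * (1 / (2 * a' * b') - 1 / (2 * a * b)) ≤ (C₁ + C₂) * (1 / (2 * a' * b')) := by
  have e1 : x * (1 / (2 * a' * b') - 1 / (2 * a * b)) =
      (x * (a - a') * b + a' * (x * (b - b'))) / (2 * a' * b' * (a * b)) := by
    field_simp
    ring
  have e2 : (C₁ + C₂) * (1 / (2 * a' * b')) =
      (C₁ * a * b + a * (C₂ * b)) / (2 * a' * b' * (a * b)) := by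
    field_simp
  have e3 : a' * (x * (b - b')) ≤ a * (C₂ * b) :=
    (mul_le_mul_of_nonneg_left h₂ ha'.le).trans (mul_le_mul_of_nonneg_right haa (by positivity))
  rw [e1, e2]
  exact div_le_div_of_nonneg_right
    (add_le_add (mul_le_mul_of_nonneg_right h₁ hb.le) e3) (by positivity)

/-- Regularity of the coefficients: the discrete derivative of `n g n` is comparable to `g`. -/
lemma exists_abs_kernelCoeff_sub_le (hω : IsUpperDoubling ω) (hμ : IsUpperDoubling μ) :
    ∃ (C : ℝ) (K : ℕ), ∀ (n : ℕ) (t : ℝ), 0 ≤ t → t < 1 →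
      |((n : ℝ) + 1) * kernelCoeff ω μ (n + 1) - n * kernelCoeff ω μ n| ≤
        C * (1 + n * (1 - t)) ^ K * invTail ω μ t := by
  obtain ⟨C, K, -, h⟩ := exists_kernelCoeff_succ_le hω hμ
  obtain ⟨C₁, hC₁, h₁⟩ := hω.exists_mul_moment_sub_le
  obtain ⟨C₂, hC₂, h₂⟩ := hμ.exists_mul_moment_sub_le
  refine ⟨(1 + C₁ + C₂) * C, K, fun n t ht ht1 => ?_⟩
  have hg := kernelCoeff_pos hω.toIsRadialWeight hμ.toIsRadialWeight (n + 1)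
  have hmono := kernelCoeff_mono hω.toIsRadialWeight hμ.toIsRadialWeight n
  have hdiff : n * (kernelCoeff ω μ (n + 1) - kernelCoeff ω μ n) ≤
      (C₁ + C₂) * kernelCoeff ω μ (n + 1) := by
    have a1 := h₁ n
    have a2 := h₂ n
    have m1 := hω.toIsRadialWeight.moment_pos (2 * n + 1)
    have m2 := hμ.toIsRadialWeight.moment_pos (2 * n + 1)
    have m3 := hω.toIsRadialWeight.moment_pos (2 * n + 3)
    have m4 := hμ.toIsRadialWeight.moment_pos (2 * n + 3)
    have m5 := hω.toIsRadialWeight.moment_anti (show 2 * n + 1 ≤ 2 * n + 3 by omega)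
    rw [kernelCoeff, kernelCoeff, show 2 * (n + 1) + 1 = 2 * n + 3 by ring]
    exact mul_one_div_sub_one_div_le m1 m3 m2 m4 m5 hC₂.le a1 a2
  have hn : 0 ≤ n * (kernelCoeff ω μ (n + 1) - kernelCoeff ω μ n) :=
    mul_nonneg n.cast_nonneg (sub_nonneg.2 hmono)
  have heq : ((n : ℝ) + 1) * kernelCoeff ω μ (n + 1) - n * kernelCoeff ω μ n =
      kernelCoeff ω μ (n + 1) + n * (kernelCoeff ω μ (n + 1) - kernelCoeff ω μ n) := by ring
  rw [heq, abs_of_nonneg (by linarith)]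
  calc _ ≤ (1 + C₁ + C₂) * kernelCoeff ω μ (n + 1) := by linarith
    _ ≤ (1 + C₁ + C₂) * (C * (1 + n * (1 - t)) ^ K * invTail ω μ t) :=
        mul_le_mul_of_nonneg_left (h n t ht ht1) (by positivity)
    _ = _ := by ring

/-- The condition on `n` says `t ≤ 1 - 1/(2n+1)`, so the moments of order `2n+1` are bounded by the
tails at that point, hence by those at `t`. -/
lemma exists_mul_invTail_le_kernelCoeff (hω : IsUpperDoubling ω) (hμ : IsUpperDoubling μ) :
    ∃ c : ℝ, 0 < c ∧ ∀ (n : ℕ) (t : ℝ), 0 ≤ t → t < 1 → 1 ≤ (2 * n + 1) * (1 - t) →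
      c * invTail ω μ t ≤ kernelCoeff ω μ n := by
  obtain ⟨A₁, hA₁, h₁⟩ := hω.exists_moment_le_tail
  obtain ⟨A₂, hA₂, h₂⟩ := hμ.exists_moment_le_tail
  refine ⟨1 / (2 * A₁ * A₂), by positivity, fun n t ht ht1 hn => ?_⟩
  have hp : (0 : ℝ) < (2 * n + 1 : ℕ) := by positivity
  have hle : t ≤ 1 - 1 / (2 * n + 1 : ℕ) := by
    rw [le_sub_comm, div_le_iff₀ hp]
    push_cast
    linarith
  have hle1 : (1 : ℝ) - 1 / (2 * n + 1 : ℕ) ≤ 1 := by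
    have : (0 : ℝ) < 1 / (2 * n + 1 : ℕ) := by positivity
    linarith
  have e1 : moment ω (2 * n + 1) ≤ A₁ * tail ω t := (h₁ (2 * n + 1) (by omega)).trans
    (mul_le_mul_of_nonneg_left (hω.toIsRadialWeight.tail_anti ht hle hle1) hA₁.le)
  have e2 : moment μ (2 * n + 1) ≤ A₂ * tail μ t := (h₂ (2 * n + 1) (by omega)).trans
    (mul_le_mul_of_nonneg_left (hμ.toIsRadialWeight.tail_anti ht hle hle1) hA₂.le)
  have m1 := hω.toIsRadialWeight.moment_pos (2 * n + 1)
  have m2 := hμ.toIsRadialWeight.moment_pos (2 * n + 1)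
  have t1 := hω.tail_pos t ⟨ht, ht1⟩
  have t2 := hμ.tail_pos t ⟨ht, ht1⟩
  calc 1 / (2 * A₁ * A₂) * invTail ω μ t = 1 / (2 * (A₁ * tail ω t) * (A₂ * tail μ t)) := by
        rw [invTail]
        field_simp
    _ ≤ kernelCoeff ω μ n := by
        rw [kernelCoeff]
        gcongr

end Coefficients

/-- The integral mean of `D^μ(B^ω_a)` depends only on `r ‖a‖`. -/
lemma integralMean_fracDeriv_bergmanKernel {ω : ℝ → ℝ} (hω : IsRadialWeight ω) (μ : ℝ → ℝ) {a : ℂ}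
    (ha : ‖a‖ < 1) (r : ℝ) :
    integralMean 1 r (fracDeriv μ (bergmanKernel ω a)) =
      seriesMean (kernelCoeff ω μ) (r * ‖a‖) := by
  obtain ⟨Ψ, hΨ⟩ : ∃ Ψ : ℝ → ℝ, Ψ = fun θ : ℝ => ‖∑' n, (kernelCoeff ω μ n : ℂ) *
      (((r * ‖a‖ : ℝ) : ℂ) * Complex.exp (θ * Complex.I)) ^ n‖ := ⟨_, rfl⟩
  -- Multiplication by `conj a` scales by `‖a‖` and rotates by `-arg a`; the rotation disappears by
  -- periodicity.
  have hpt : ∀ θ : ℝ, ‖fracDeriv μ (bergmanKernel ω a) (r * Complex.exp (θ * Complex.I))‖ =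
      Ψ (θ - Complex.arg a) := fun θ => by
    rw [hΨ, fracDeriv]
    congr 1
    refine tsum_congr fun n => ?_
    have hconj : conj a = ‖a‖ * Complex.exp (-(Complex.arg a * Complex.I)) := by
      conv_lhs => rw [← Complex.norm_mul_exp_arg_mul_I a]
      rw [map_mul, Complex.conj_ofReal, ← Complex.exp_conj, map_mul, Complex.conj_ofReal,
        Complex.conj_I, mul_neg]
    have hexp : ((r * ‖a‖ : ℝ) : ℂ) * Complex.exp ((θ - Complex.arg a : ℝ) * Complex.I) =
        conj a * (r * Complex.exp (θ * Complex.I)) := by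
      rw [hconj]
      push_cast
      rw [sub_mul, sub_eq_add_neg, Complex.exp_add]
      ring
    rw [hexp, hω.taylorCoeff_bergmanKernel ha, kernelCoeff, mul_pow (conj a)]
    push_cast
    rw [div_div, div_eq_mul_one_div]
    ring
  have hper : Function.Periodic Ψ (2 * π) := fun θ => by
    rw [hΨ]
    simp only
    push_cast
    rw [add_mul, Complex.exp_add, Complex.exp_two_pi_mul_I, mul_one]
  rw [integralMean, seriesMean, div_one, Real.rpow_one]
  simp_rw [Real.rpow_one, hpt]
  rw [intervalIntegral.integral_comp_sub_right Ψ, zero_sub, sub_eq_neg_add,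
    hper.intervalIntegral_add_eq _ 0, zero_add, hΨ]

end BergmanDisc

/-! ### The two-sided estimate -/

open BergmanDisc

theorem proposition2p4 (ω μ : ℝ → ℝ)
    (hω : BergmanDisc.IsUpperDoubling ω) (hμ : BergmanDisc.IsUpperDoubling μ) :
    ∃ c C : ℝ, 0 < c ∧ 0 < C ∧ ∀ a : ℂ, ‖a‖ < 1 → ∀ r : ℝ, 0 ≤ r → r < 1 →
      c * (1 + ∫ t in (0 : ℝ)..r * ‖a‖,
          1 / (BergmanDisc.tail ω t * BergmanDisc.tail μ t * (1 - t))) ≤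
        BergmanDisc.integralMean 1 r
          (BergmanDisc.fracDeriv μ (BergmanDisc.bergmanKernel ω a)) ∧
      BergmanDisc.integralMean 1 r
          (BergmanDisc.fracDeriv μ (BergmanDisc.bergmanKernel ω a)) ≤
        C * (1 + ∫ t in (0 : ℝ)..r * ‖a‖,
          1 / (BergmanDisc.tail ω t * BergmanDisc.tail μ t * (1 - t))) := by
  have hω' := hω.toIsRadialWeight
  have hμ' := hμ.toIsRadialWeight
  have hg := kernelCoeff_pos hω' hμ'
  obtain ⟨B, K, hB⟩ := exists_kernelCoeff_le_pow hω hμ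
  obtain ⟨C, K', hd⟩ := exists_abs_kernelCoeff_sub_le hω hμ
  obtain ⟨c, hc, hlow⟩ := exists_mul_invTail_le_kernelCoeff hω hμ
  have hcont := continuousOn_invTail hω' hμ'
  obtain ⟨D, hD, hup⟩ := exists_seriesMean_le (fun n => (hg n).le) hB hcont
    (fun t ht ht1 => invTail_pos hω' hμ' ht ht1) hd
  have hc' : 0 < π⁻¹ * (c / 2) := by positivity
  -- The halving undoes the factor 2 of Hardy's inequality; `min` and `max` merge the coefficients
  -- of the constant term and of the integral.
  refine ⟨min (kernelCoeff ω μ 0) (π⁻¹ * (c / 2)) / 2, max (kernelCoeff ω μ 0) D,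
    half_pos (lt_min (hg 0) hc'), lt_max_of_lt_right hD, fun a ha r hr hr1 => ?_⟩
  have hρ : 0 ≤ r * ‖a‖ := by positivity
  have hρ1 : r * ‖a‖ < 1 := mul_lt_one_of_nonneg_of_lt_one_left hr hr1 ha.le
  have hint : ∫ t in (0 : ℝ)..r * ‖a‖, 1 / (tail ω t * tail μ t * (1 - t)) =
      ∫ t in (0 : ℝ)..r * ‖a‖, invTail ω μ t / (1 - t) := by
    simp_rw [invTail, div_div]
  have hI : 0 ≤ ∫ t in (0 : ℝ)..r * ‖a‖, invTail ω μ t / (1 - t) :=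
    intervalIntegral.integral_nonneg hρ fun t ht =>
      div_nonneg (invTail_pos hω' hμ' ht.1 (ht.2.trans_lt hρ1)).le (by linarith [ht.2])
  rw [integralMean_fracDeriv_bergmanKernel hω' μ ha, hint]
  constructor
  · have h1 := le_seriesMean (fun n => (hg n).le) hB hcont hlow hρ hρ1
    have h2 := min_le_left (kernelCoeff ω μ 0) (π⁻¹ * (c / 2))
    have h3 := mul_le_mul_of_nonneg_right
      (min_le_right (kernelCoeff ω μ 0) (π⁻¹ * (c / 2))) hI
    linarith
  · have h1 := hup _ hρ hρ1
    have h2 := le_max_left (kernelCoeff ω μ 0) D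
    have h3 := mul_le_mul_of_nonneg_right (le_max_right (kernelCoeff ω μ 0) D) hI
    linarith

end
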